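/- **Language.** Fix a set $\mathsf{AtProp}$ of atomic propositions $p$ and a set $\mathsf{AtRes}$ of atomic resources $a$. There are two types, $\mathsf{Fm}$ (formulas) and $\mathsf{Res}$ (resources). Operational terms of type $\mathsf{Res}$ and $\mathsf{Fm}$ are given by $$\alpha ::= a \mid 1 \mid 0 \mid \alpha\cdot\alpha \mid \alpha\sqcup\alpha \mid \alpha\sqcap\alpha,\qquad A ::= p \mid \top \mid \bot \mid A\vee A \mid A\wedge A \mid A\to A \mid \alpha\triangleright A \mid \Diamond A \mid \Diamond_r\alpha \mid \alpha\triangleright_r\alpha .$$ Structures $X,Y,Z,W$ of type $\mathsf{Fm}$ and $\Gamma,\Delta,\Sigma,\Pi$ of type $\mathsf{Res}$ are built from operational terms with the structural connectives $$\mathrm I,\ X;Y,\ X>Y,\ X<Y,\ \circ X,\ \bullet X,\ \circ_r\Gamma,\ \Gamma\,\hat\triangleright\,X,\ \Gamma\,\hat\triangleright_r\,\Delta\ :\ \mathsf{Fm},$$ $$\Phi,\ (\Gamma,\Delta),\ \Gamma\sqsupset\Delta,\ \Gamma\sqsubset\Delta,\ \Gamma\odot\Delta,\ \Gamma\gtrdot\Delta,\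 \Gamma\lessdot\Delta,\ \bullet_r X,\ X\,\hat\blacktriangleright\,Y,\ X\,\hat\blacktriangleright_r\,\Delta,\ \Gamma\,\hat\blacktriangle_r\,X\ :\ \mathsf{Res}.$$ Every coordinate is positive, except the first coordinate of $>,\sqsupset,\gtrdot,\hat\triangleright,\hat\triangleright_r,\hat\blacktriangleright,\hat\blacktriangleright_r$ and the second coordinate of $<,\sqsubset,\lessdot$, which are negative. In a sequent $x\vdash y$ the root of $x$ is a precedent part and the root of $y$ a succedent part; positive coordinates preserve and negative ones exchange these roles. A sequent is type-uniform if both sides have the same type. **The calculus D.LRC** has the following rules ($\Vert$ separates the two sequents of a rule that may be used in both directions, $/$ separates premises from conclusion). *Cuts* (on a formula $A$, at one occurrence of $A$ as a succedent part of a sequent of type $\mathsf{Fm}$; and on a resource term $\alpha$ in display): $$(X\vdash Y)[A]^{succ},\ A\vdash Z\ /\ (X\vdash Y)[Z/A]^{succ};\qquad \Gamma\vdash\alpha,\ \alpha\vdash\Delta\ /\ \Gamma\vdash\Delta.$$ *Identity*: $p\vdash p$; $a\vdash a$. *Display postulates*: $X;Y\vdash Z\Vert Y\vdash X>Z$; $Z\vdash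 X;Y\Vert X>Z\vdash Y$; $X;Y\vdash Z\Vert X\vdash Z<Y$; $Z\vdash X;Y\Vert Z<Y\vdash X$; $\Gamma,\Delta\vdash\Sigma\Vert\Delta\vdash\Gamma\sqsupset\Sigma$; $\Gamma,\Delta\vdash\Sigma\Vert\Gamma\vdash\Sigma\sqsubset\Delta$; $\Gamma\vdash\Delta,\Sigma\Vert\Delta\sqsupset\Gamma\vdash\Sigma$; $\Gamma\vdash\Delta,\Sigma\Vert\Gamma\sqsubset\Sigma\vdash\Delta$; $\Gamma\odot\Delta\vdash\Sigma\Vert\Delta\vdash\Gamma\gtrdot\Sigma$; $\Gamma\odot\Delta\vdash\Sigma\Vert\Gamma\vdash\Sigma\lessdot\Delta$; $\circ X\vdash Y\Vert X\vdash\bullet Y$; $\circ_r\Gamma\vdash X\Vert\Gamma\vdash\bullet_r X$; $X\vdash\Gamma\hat\triangleright Y\Vert\Gamma\vdash X\hat\blacktriangleright Y$; $X\vdash\Gamma\hat\triangleright_r\Delta\Vert\Gamma\hat\blacktriangle_r X\vdash\Delta$; $X\vdash\Gamma\hat\triangleright_r\Delta\Vert\Gamma\vdash X\hat\blacktriangleright_r\Delta$.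 *Structural rules of type* $\mathsf{Fm}$: $X\vdash Y\Vert\mathrm I;X\vdash Y$; $Y\vdash X\Vert Y\vdash X;\mathrm I$; $Y;X\vdash Z/X;Y\vdash Z$; $Z\vdash X;Y/Z\vdash Y;X$; $Y\vdash Z/X;Y\vdash Z$; $Z\vdash Y/Z\vdash Y;X$; $X;X\vdash Y/X\vdash Y$; $Y\vdash X;X/Y\vdash X$; $X;(Y;Z)\vdash W\Vert(X;Y);Z\vdash W$; $W\vdash(Z;Y);X\Vert W\vdash Z;(Y;X)$. *Structural rules of type* $\mathsf{Res}$: $\Gamma\odot\Phi\vdash\Delta\Vert\Gamma\vdash\Delta$; $\Gamma\vdash\Delta\Vert\Phi\odot\Gamma\vdash\Delta$; $\Gamma\vdash\Delta\Vert\Gamma\vdash\Delta,\Phi$; $\Gamma\odot(\Delta\odot\Sigma)\vdash\Pi\Vert(\Gamma\odot\Delta)\odot\Sigma\vdash\Pi$; $\Phi\vdash\Delta/\Gamma\vdash\Delta$; $\Gamma\vdash\Delta/\Gamma,\Sigma\vdash\Delta$; $\Gamma\vdash\Delta/\Gamma\vdash\Delta,\Sigma$; $\Gamma,\Gamma\vdash\Delta/\Gamma\vdash\Delta$;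 $\Gamma\vdash\Delta,\Delta/\Gamma\vdash\Delta$; $\Gamma,\Delta\vdash\Sigma/\Delta,\Gamma\vdash\Sigma$; $\Sigma\vdash\Gamma,\Delta/\Sigma\vdash\Delta,\Gamma$; $\Sigma,(\Delta,\Gamma)\vdash\Pi\Vert(\Sigma,\Delta),\Gamma\vdash\Pi$; $\Pi\vdash\Sigma,(\Delta,\Gamma)\Vert\Pi\vdash(\Sigma,\Delta),\Gamma$; $\Pi\vdash(\Gamma\gtrdot\Delta),(\Gamma\gtrdot\Sigma)/\Pi\vdash\Gamma\gtrdot(\Delta,\Sigma)$. *Interaction structural rules*: $X\vdash\bullet Y;\bullet Z/X\vdash\bullet(Y;Z)$; $\Gamma\vdash\bullet_r X,\bullet_r Y/\Gamma\vdash\bullet_r(X;Y)$; $X\vdash\mathrm I/X\vdash\bullet\mathrm I$; $\Gamma\vdash\Phi/\Gamma\vdash\bullet_r\mathrm I$; $\Gamma\vdash(Y\hat\blacktriangleright_r\Delta),(Z\hat\blacktriangleright_r\Delta)/\Gamma\vdash(Y;Z)\hat\blacktriangleright_r\Delta$; $\Gamma\vdash(Y\hat\blacktriangleright W),(Z\hat\blacktriangleright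 W)/\Gamma\vdash(Y;Z)\hat\blacktriangleright W$; $(\Gamma\hat\blacktriangle_r X),(\Gamma\hat\blacktriangle_r Y)\vdash\Delta/\Gamma\hat\blacktriangle_r(X;Y)\vdash\Delta$; $X\vdash\Gamma\hat\triangleright(\Delta\hat\triangleright Y)/X\vdash(\Gamma\odot\Delta)\hat\triangleright Y$; $\Phi\vdash\Delta/\Gamma\hat\blacktriangle_r\mathrm I\vdash\Delta$; $X\vdash\Gamma\hat\triangleright\bullet Y/X\vdash(\circ_r\Gamma)>Y$; $X\vdash\Gamma\hat\triangleright_r\bullet_r Y/X\vdash\Gamma\hat\triangleright Y$. *Introduction rules*: $\bot\vdash\mathrm I$; $X\vdash\mathrm I/X\vdash\bot$; $\mathrm I\vdash X/\top\vdash X$; $\mathrm I\vdash\top$; $A;B\vdash X/A\wedge B\vdash X$; $X\vdash A$ and $Y\vdash B/X;Y\vdash A\wedge B$; $A\vdash X$ and $B\vdash Y/A\vee B\vdash X;Y$; $X\vdash A;B/X\vdash A\vee B$; $X\vdash A$ and $B\vdash Y/A\to B\vdash X>Y$; $X\vdash A>B/X\vdash A\to B$; $0\vdash\Phi$; $\Gamma\vdash\Phi/\Gamma\vdash0$;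 $\Phi\vdash\Gamma/1\vdash\Gamma$; $\Phi\vdash1$; $\alpha\odot\beta\vdash\Gamma/\alpha\cdot\beta\vdash\Gamma$; $\Gamma\vdash\alpha$ and $\Delta\vdash\beta/\Gamma\odot\Delta\vdash\alpha\cdot\beta$; $\alpha\vdash\Gamma$ and $\beta\vdash\Delta/\alpha\sqcup\beta\vdash\Gamma,\Delta$; $\Gamma\vdash\alpha,\beta$ (one premise) $/\Gamma\vdash\alpha\sqcup\beta$; $\alpha,\beta\vdash\Gamma$ (one premise) $/\alpha\sqcap\beta\vdash\Gamma$; $\Gamma\vdash\alpha$ and $\Delta\vdash\beta/\Gamma,\Delta\vdash\alpha\sqcap\beta$; $\circ A\vdash X/\Diamond A\vdash X$; $X\vdash A/\circ X\vdash\Diamond A$; $\Gamma\vdash\alpha$ and $A\vdash X/\alpha\triangleright A\vdash\Gamma\hat\triangleright X$; $X\vdash\alpha\hat\triangleright A/X\vdash\alpha\triangleright A$; $\circ_r\alpha\vdash X/\Diamond_r\alpha\vdash X$; $\Gamma\vdash\alpha/\circ_r\Gamma\vdash\Diamond_r\alpha$; $\Gamma\vdash\alpha$ and $\beta\vdash\Delta/\alpha\triangleright_r\beta\vdash\Gamma\hat\triangleright_r\Delta$;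 $X\vdash\alpha\hat\triangleright_r\beta/X\vdash\alpha\triangleright_r\beta$. **Proper calculi.** In an application of a rule, the parameters are the parts lying inside structures substituted for the structure variables of the rule, and two of them are congruent if they are corresponding parts of (occurrences of) the same variable. In a cut, the parameters are the parts of the left premise not containing the displayed occurrence of the cut term, each congruent to its copy in the conclusion, and the parts of $Z$, each congruent to its copy in the conclusion. A term occurring in the conclusion is principal if it is not parametric. A calculus is a *proper multi-type calculus* if: - (C$_1$) in every rule other than cut, each operational term occurring in a premise is a subterm of one occurring in the conclusion; - (C$_2$, C$_2'$) congruent parameters are occurrences of the same structure, of the same type; - (C$_3$) each parameter is congruent to at most one part of the conclusion; - (C$_4$) congruent parameters are all precedent or all succedent parts; - (C$_5'$) a principal term of the conclusion is in display (i.e. is a whole side of the sequent), unless the sequent is an axiom; - (C$_5''$) a term principal in an axiom can be isolated by display postulates so that the new sequent is an axiom; - (C$_5'''$) if $(x\vdash y)([a]^{pre},[a]^{suc})$, $a\vdash z[a]^{suc}$ and $v[a]^{pre}\vdash a$ are axioms, then so are $(x\vdash y)([a]^{pre},[z/a]^{suc})$ and $(x\vdash y)([v/a]^{pre},[a]^{suc})$;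 - (C$_6'$, C$_7'$) each rule is closed under simultaneous substitution of an arbitrary structure for all occurrences congruent to a parametric operational term of the same type in succedent, resp. precedent, position; - (C$_8'$) if in a cut both occurrences of the cut term are principal in the last rule applications above the two premises of the cut, then the conclusion of the cut can be derived from the premises of these two applications using rules other than cut and cuts on proper subterms of the cut term which are strongly type-uniform (all sequents of the cut are type-uniform of one and the same type); - (C$_9$) every derivable sequent is type-uniform; - (C$_{10}$) the cut rules preserve type-uniformity. **Theorem.** D.LRC is a proper multi-type calculus; in particular C$_8'$ holds for cut terms of the form $\alpha\triangleright A$. Moreover, D.LRC enjoys 1. *cut elimination*: every derivable sequent has a derivation without applications of the cut rules; 2. *the subformula property*: every operational term occurring in a cut-free derivation is a subterm of an operational term occurring in its end sequent; hence every derivable sequent has a (cut-free) derivation in which only subterms of terms of that sequent occur. -/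

import Mathlib

namespace DLRC

universe u v

/-! ### Language: types, operational terms, structures, sequents -/

/-- The two types: formulas and resources. -/
inductive Ty
  | fm
  | res
  deriving DecidableEq

open Ty

/-- Operational terms of LRC over atomic propositions `P` and atomic resources `Q`:
terms of type `fm` are the formulas, terms of type `res` are the resource terms. -/
inductive Tm (P : Type u) (Q : Type v) : Ty → Type (max u v)
  | prop (p : P) : Tm P Q fm
  | top : Tm P Q fm
  | bot : Tm P Q fm
  | or (A B : Tm P Q fm) : Tm P Q fm
  | and (A B : Tm P Q fm) : Tm P Q fm
  | imp (A B : Tm P Q fm) : Tm P Q fm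
  /-- `α ▷ A`: using `α` the agent is capable of bringing about `A`. -/
  | cap (α : Tm P Q res) (A : Tm P Q fm) : Tm P Q fm
  /-- `◇ A`: the agent is able to bring about `A`. -/
  | dia (A : Tm P Q fm) : Tm P Q fm
  /-- The diamond from resources to formulas: the agent possesses `α`. -/
  | poss (α : Tm P Q res) : Tm P Q fm
  /-- The barred triangle: the agent is capable of getting `β` from `α`. -/
  | get (α β : Tm P Q res) : Tm P Q fm
  | atom (a : Q) : Tm P Q res
  | one : Tm P Q res
  | zero : Tm P Q res
  /-- `α · β` -/
  | fuse (α β : Tm P Q res) : Tm P Q res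
  /-- `α ⊔ β` -/
  | join (α β : Tm P Q res) : Tm P Q res
  /-- `α ⊓ β` -/
  | meet (α β : Tm P Q res) : Tm P Q res

/-- Operational terms of either type. -/
abbrev AnyTm (P : Type u) (Q : Type v) := Σ t, Tm P Q t

section
variable {P : Type u} {Q : Type v}

/-- The immediate subterms of a term (they may be of the other type). -/
def Tm.children : {t : Ty} → Tm P Q t → List (AnyTm P Q)
  | _, .prop _ => []
  | _, .top => []
  | _, .bot => []
  | _, .or A B => [⟨_, A⟩, ⟨_, B⟩]
  | _, .and A B => [⟨_, A⟩, ⟨_, B⟩]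
  | _, .imp A B => [⟨_, A⟩, ⟨_, B⟩]
  | _, .cap α A => [⟨_, α⟩, ⟨_, A⟩]
  | _, .dia A => [⟨_, A⟩]
  | _, .poss α => [⟨_, α⟩]
  | _, .get α β => [⟨_, α⟩, ⟨_, β⟩]
  | _, .atom _ => []
  | _, .one => []
  | _, .zero => []
  | _, .fuse α β => [⟨_, α⟩, ⟨_, β⟩]
  | _, .join α β => [⟨_, α⟩, ⟨_, β⟩]
  | _, .meet α β => [⟨_, α⟩, ⟨_, β⟩]

def ImmSub (a b : AnyTm P Q) : Prop := a ∈ b.2.children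

/-- `a` is a subterm of `b`. -/
def Subterm : AnyTm P Q → AnyTm P Q → Prop := Relation.ReflTransGen ImmSub

/-- `a` is a proper subterm of `b`. -/
def ProperSubterm : AnyTm P Q → AnyTm P Q → Prop := Relation.TransGen ImmSub

end

/-- Precedent and succedent parts. -/
inductive Part
  | pre
  | suc
  deriving DecidableEq

def Part.flip : Part → Part
  | pre => suc
  | suc => pre

open _root_.DLRC.Part

/-- Nullary structural connectives: `I` and `Φ`. -/
inductive Nul : Ty → Type
  | I : Nul fm
  | Phi : Nul res

/-- Unary structural connectives, all of positive polarity. -/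
inductive Un : Ty → Ty → Type
  /-- `∘`, the structural counterpart of `◇`. -/
  | circ : Un fm fm
  /-- `•`, the structural right adjoint of `∘`. -/
  | bull : Un fm fm
  /-- The barred `∘`, the structural counterpart of `poss`. -/
  | circR : Un res fm
  /-- The barred `•`, the structural right adjoint of `circR`. -/
  | bullR : Un fm res

/-- Binary structural connectives; `Bin s t u` takes a structure of type `s` and one of type `t`
to a structure of type `u`. -/
inductive Bin : Ty → Ty → Ty → Type
  /-- `;` -/
  | semi : Bin fm fm fm
  /-- `>` -/
  | gt : Bin fm fm fm
  /-- `<` -/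
  | lt : Bin fm fm fm
  /-- `,` -/
  | comma : Bin res res res
  /-- `⊐` -/
  | sqR : Bin res res res
  /-- `⊏` -/
  | sqL : Bin res res res
  /-- `⊙` -/
  | odot : Bin res res res
  /-- `⋗` -/
  | resR : Bin res res res
  /-- `⋖` -/
  | resL : Bin res res res
  /-- structural `▷` -/
  | tri : Bin res fm fm
  /-- structural `▶`, the Galois adjoint of `tri` in its first coordinate -/
  | btri : Bin fm fm res
  /-- structural barred `▷` -/
  | triR : Bin res res fm
  /-- structural barred `▶`, the Galois adjoint of `triR` in its first coordinate -/
  | btriR : Bin fm res res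
  /-- structural barred `▲`, the left adjoint of `triR` in its second coordinate -/
  | up : Bin res fm res

/-- How the first coordinate of a binary connective transforms the part. -/
def Bin.fstPart {s t u : Ty} : Bin s t u → Part → Part
  | .gt, ρ | .sqR, ρ | .resR, ρ | .tri, ρ | .btri, ρ | .triR, ρ | .btriR, ρ => ρ.flip
  | .semi, ρ | .lt, ρ | .comma, ρ | .sqL, ρ | .odot, ρ | .resL, ρ | .up, ρ => ρ

/-- How the second coordinate of a binary connective transforms the part. -/
def Bin.sndPart {s t u : Ty} : Bin s t u → Part → Part
  | .lt, ρ | .sqL, ρ | .resL, ρ => ρ.flip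
  | .semi, ρ | .gt, ρ | .comma, ρ | .sqR, ρ | .odot, ρ | .resR, ρ | .tri, ρ | .btri, ρ
  | .triR, ρ | .btriR, ρ | .up, ρ => ρ

/-- Structures with structure variables named by `V` (a variable has a name and a type).
Structures proper are the case `V = Empty`; the case `V = ℕ` is used to write rules. -/
inductive Str (P : Type u) (Q : Type v) (V : Type) : Ty → Type (max u v)
  | var {t : Ty} (n : V) : Str P Q V t
  | tm {t : Ty} (a : Tm P Q t) : Str P Q V t
  | nul {t : Ty} (c : Nul t) : Str P Q V t
  | un {s t : Ty} (c : Un s t) (x : Str P Q V s) : Str P Q V t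
  | bin {s t w : Ty} (c : Bin s t w) (x : Str P Q V s) (y : Str P Q V t) : Str P Q V w

/-- A sequent `x ⊢ y`; the two sides are not required to have the same type. -/
structure Seq (P : Type u) (Q : Type v) (V : Type) : Type (max u v) where
  {lty : Ty}
  {rty : Ty}
  ante : Str P Q V lty
  cons : Str P Q V rty

/-- Structures without variables. -/
abbrev Structure (P : Type u) (Q : Type v) (t : Ty) := Str P Q Empty t

/-- Sequents without variables. -/
abbrev Sequent (P : Type u) (Q : Type v) := Seq P Q Empty

inductive Dir
  | fst
  | snd

/-- The address of a substructure in a structure. -/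
abbrev Path := List Dir

/-- The address of a substructure in a sequent: the side and the path from the root of that side. -/
abbrev Pos := Part × Path

section
variable {P : Type u} {Q : Type v} {V : Type}

/-- `Occ π x p ρ y`: if `x` is a `π`-part, then `y` occurs in `x` at `p`, as a `ρ`-part. -/
inductive Str.Occ : {t w : Ty} → Part → Str P Q V t → Path → Part → Str P Q V w → Prop
  | here {t : Ty} {π : Part} (x : Str P Q V t) : Str.Occ π x [] π x
  | un {s t w : Ty} {π ρ : Part} {p : Path} (c : Un s t) {x : Str P Q V s} {y : Str P Q V w} :
      Str.Occ π x p ρ y → Str.Occ π (.un c x) (.fst :: p) ρ y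
  | fst {s t k w : Ty} {π ρ : Part} {p : Path} (c : Bin s t k) {x : Str P Q V s}
      {x' : Str P Q V t} {y : Str P Q V w} :
      Str.Occ (c.fstPart π) x p ρ y → Str.Occ π (.bin c x x') (.fst :: p) ρ y
  | snd {s t k w : Ty} {π ρ : Part} {p : Path} (c : Bin s t k) {x : Str P Q V s}
      {x' : Str P Q V t} {y : Str P Q V w} :
      Str.Occ (c.sndPart π) x' p ρ y → Str.Occ π (.bin c x x') (.snd :: p) ρ y

/-- `y` occurs in the sequent `S` at `o`, as a `ρ`-part of `S`. -/
def Seq.Occ (S : Seq P Q V) (o : Pos) (ρ : Part) {w : Ty} (y : Str P Q V w) : Prop :=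
  match o with
  | (.pre, p) => S.ante.Occ pre p ρ y
  | (.suc, p) => S.cons.Occ suc p ρ y

/-- The operational term `a` occurs in `S` (as a substructure). -/
def Seq.HasTerm (S : Seq P Q V) (a : AnyTm P Q) : Prop :=
  ∃ o ρ, S.Occ o ρ (.tm a.2)

def Seq.TypeUniform (S : Seq P Q V) : Prop := S.lty = S.rty

open Classical in
/-- Put `z` in place of `d` if `here` holds and the types agree. -/
noncomputable def graft {t w : Ty} (here : Prop) (z : Str P Q V w) (d : Str P Q V t) :
    Str P Q V t :=
  if h : here ∧ w = t then h.2 ▸ z else d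

/-- Simultaneous replacement by `z` of the substructures, of the type of `z`, at the addresses
satisfying `at'`. -/
noncomputable def Str.replace {w : Ty} (z : Str P Q V w) :
    {t : Ty} → Str P Q V t → (at' : Path → Prop) → Str P Q V t
  | _, .var n, at' => graft (at' []) z (.var n)
  | _, .tm a, at' => graft (at' []) z (.tm a)
  | _, .nul c, at' => graft (at' []) z (.nul c)
  | _, .un c x, at' => graft (at' []) z (.un c (Str.replace z x fun p => at' (.fst :: p)))
  | _, .bin c x y, at' => graft (at' []) z
      (.bin c (Str.replace z x fun p => at' (.fst :: p)) (Str.replace z y fun p => at' (.snd :: p)))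

/-- Simultaneous replacement by `z` in a sequent. -/
noncomputable def Seq.replace {w : Ty} (z : Str P Q V w) (S : Seq P Q V) (at' : Pos → Prop) :
    Seq P Q V :=
  ⟨Str.replace z S.ante fun p => at' (.pre, p), Str.replace z S.cons fun p => at' (.suc, p)⟩

/-- Substitution of structures for structure variables. -/
def Str.subst {W : Type} (σ : (t : Ty) → V → Str P Q W t) : {t : Ty} → Str P Q V t → Str P Q W t
  | _, .var n => σ _ n
  | _, .tm a => .tm a
  | _, .nul c => .nul c
  | _, .un c x => .un c (x.subst σ)
  | _, .bin c x y => .bin c (x.subst σ) (y.subst σ)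

def Seq.subst {W : Type} (σ : (t : Ty) → V → Str P Q W t) (S : Seq P Q V) : Seq P Q W :=
  ⟨S.ante.subst σ, S.cons.subst σ⟩

end

/-! ### Rules, calculi, derivations -/

/-- A location in an inference: the conclusion (`none`) or the `i`-th premise (`some i`), and an
address in that sequent. -/
abbrev Loc := Option ℕ × Pos

/-- An analysed application of a rule: premises, conclusion, and the congruence relation on
the locations of its parameters. A location is parametric iff it is congruent to itself. -/
structure Inference (P : Type u) (Q : Type v) : Type (max u v) where
  prems : List (Sequent P Q)
  concl : Sequent P Q
  cong : Loc → Loc → Prop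

/-- A rule is the set of its applications. -/
abbrev Rule (P : Type u) (Q : Type v) := Set (Inference P Q)

section
variable {P : Type u} {Q : Type v}

/-- `y` occurs, as a `ρ`-part, at location `l` of the inference. -/
def Inference.Occ (J : Inference P Q) (l : Loc) (ρ : Part) {w : Ty} (y : Structure P Q w) : Prop :=
  match l with
  | (none, o) => J.concl.Occ o ρ y
  | (some i, o) => ∃ S, J.prems[i]? = some S ∧ S.Occ o ρ y

def Inference.Parametric (J : Inference P Q) (l : Loc) : Prop := J.cong l l

/-- The term `a`, occurring as a `ρ`-part at `o` in the conclusion, is principal there. -/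
def Inference.Principal (J : Inference P Q) (o : Pos) (ρ : Part) {t : Ty} (a : Tm P Q t) : Prop :=
  J.concl.Occ o ρ (.tm a : Structure P Q t) ∧ ¬ J.Parametric (none, o)

/-- Premises after replacement by `z` of everything congruent to location `l`. -/
noncomputable def Inference.replacePrems (J : Inference P Q) (l : Loc) {t : Ty}
    (z : Structure P Q t) : List (Sequent P Q) :=
  J.prems.mapIdx fun i S => S.replace z fun o => J.cong l (some i, o)

/-- Conclusion after replacement by `z` of everything congruent to location `l`. -/
noncomputable def Inference.replaceConcl (J : Inference P Q) (l : Loc) {t : Ty}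
    (z : Structure P Q t) : Sequent P Q :=
  J.concl.replace z fun o => J.cong l (none, o)

end

/-- A surgical cut
`(x ⊢ y)[a]^suc`, `a ⊢ z` / `(x ⊢ y)[z/a]^suc`:
the cut term `a` is a succedent part of the left premise, at address `pos`, and stands in display
in the right premise. The cut is an ordinary one if `pos = (suc, [])`. -/
structure Cut (P : Type u) (Q : Type v) : Type (max u v) where
  left : Sequent P Q
  pos : Pos
  ty : Ty
  term : Tm P Q ty
  z : Structure P Q ty
  occ : left.Occ pos suc (.tm term : Structure P Q ty)

section
variable {P : Type u} {Q : Type v}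

def Cut.right (K : Cut P Q) : Sequent P Q := ⟨(.tm K.term : Structure P Q K.ty), K.z⟩

noncomputable def Cut.concl (K : Cut P Q) : Sequent P Q := K.left.replace K.z fun o => o = K.pos

/-- The address `o` lies on the path from the root to the cut term (inclusive) of the
left premise. -/
def Cut.OnSpine (K : Cut P Q) (o : Pos) : Prop := o.1 = K.pos.1 ∧ o.2 <+: K.pos.2

/-- The parameters of a cut, each with the address of its congruent in the conclusion: the parts of
the left premise off the path to the cut term are unchanged, and the parts of `z` are found below
the address of the cut term. -/
inductive Cut.Trace (K : Cut P Q) : Loc → Pos → Prop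
  | left {o : Pos} {ρ : Part} {w : Ty} {y : Structure P Q w} :
      K.left.Occ o ρ y → ¬ K.OnSpine o → Cut.Trace K (some 0, o) o
  | right {p : Path} {ρ : Part} {w : Ty} {y : Structure P Q w} :
      K.z.Occ suc p ρ y → Cut.Trace K (some 1, (suc, p)) (K.pos.1, K.pos.2 ++ p)
  | conclLeft {o : Pos} {ρ : Part} {w : Ty} {y : Structure P Q w} :
      K.left.Occ o ρ y → ¬ K.OnSpine o → Cut.Trace K (none, o) o
  | conclRight {p : Path} {ρ : Part} {w : Ty} {y : Structure P Q w} :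
      K.z.Occ suc p ρ y →
        Cut.Trace K (none, (K.pos.1, K.pos.2 ++ p)) (K.pos.1, K.pos.2 ++ p)

noncomputable def Cut.toInference (K : Cut P Q) : Inference P Q where
  prems := [K.left, K.right]
  concl := K.concl
  cong l l' := ∃ o, K.Trace l o ∧ K.Trace l' o

/-- Premises and conclusion are all type-uniform and of one and the same type. -/
def Cut.StronglyTypeUniform (K : Cut P Q) : Prop :=
  ∃ T : Ty, ∀ S ∈ [K.left, K.right, K.concl], S.lty = T ∧ S.rty = T

end

/-- A calculus: rules other than cut, some of which are marked as display postulates,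
and cut rules. -/
structure Calculus (P : Type u) (Q : Type v) : Type (max u v) where
  rules : Set (Rule P Q)
  display : Set (Rule P Q)
  display_subset : display ⊆ rules
  cuts : Set (Set (Cut P Q))

section
variable {P : Type u} {Q : Type v}

/-- All rules of the calculus, the cut rules included. -/
def Calculus.allRules (C : Calculus P Q) : Set (Rule P Q) :=
  C.rules ∪ (fun c => Cut.toInference '' c) '' C.cuts

/-- Derivations in `C` (as trees), from hypotheses in `H`. -/
inductive Derivation (C : Calculus P Q) (H : Set (Sequent P Q)) : Sequent P Q → Type (max u v)
  | hyp {S : Sequent P Q} (h : S ∈ H) : Derivation C H S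
  | rule {R : Rule P Q} (hR : R ∈ C.rules) {J : Inference P Q} (hJ : J ∈ R)
      (ds : (i : Fin J.prems.length) → Derivation C H (J.prems.get i)) : Derivation C H J.concl
  | cut {R : Set (Cut P Q)} (hR : R ∈ C.cuts) {K : Cut P Q} (hK : K ∈ R)
      (d : Derivation C H K.left) (e : Derivation C H K.right) : Derivation C H K.concl

/-- All cuts of the derivation satisfy `p`. -/
def Derivation.AllCuts {C : Calculus P Q} {H : Set (Sequent P Q)} (p : Cut P Q → Prop) :
    {S : Sequent P Q} → Derivation C H S → Prop
  | _, .hyp _ => True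
  | _, .rule _ _ ds => ∀ i, (ds i).AllCuts p
  | _, .cut (K := K) _ _ d e => p K ∧ d.AllCuts p ∧ e.AllCuts p

/-- All sequents of the derivation satisfy `p`. -/
def Derivation.AllSequents {C : Calculus P Q} {H : Set (Sequent P Q)} (p : Sequent P Q → Prop) :
    {S : Sequent P Q} → Derivation C H S → Prop
  | S, .hyp _ => p S
  | _, .rule (J := J) _ _ ds => p J.concl ∧ ∀ i, (ds i).AllSequents p
  | _, .cut (K := K) _ _ d e => p K.concl ∧ d.AllSequents p ∧ e.AllSequents p

def Derivation.CutFree {C : Calculus P Q} {H : Set (Sequent P Q)} {S : Sequent P Q}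
    (d : Derivation C H S) : Prop := d.AllCuts fun _ => False

/-- Every operational term occurring in the derivation is a subterm of an operational term
occurring in its end sequent. -/
def Derivation.Analytic {C : Calculus P Q} {H : Set (Sequent P Q)} {S : Sequent P Q}
    (d : Derivation C H S) : Prop :=
  d.AllSequents fun S' => ∀ a, S'.HasTerm a → ∃ b, S.HasTerm b ∧ Subterm a b

def Calculus.Derivable (C : Calculus P Q) (S : Sequent P Q) : Prop := Nonempty (Derivation C ∅ S)

/-- `S` is an axiom: the conclusion of an application of a rule without premises. -/
def Calculus.IsAxiom (C : Calculus P Q) (S : Sequent P Q) : Prop :=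
  ∃ R ∈ C.rules, ∃ J ∈ R, J.prems = [] ∧ J.concl = S

/-- One application of a display postulate leads from `S` to `S'`. -/
def Calculus.DisplayStep (C : Calculus P Q) (S S' : Sequent P Q) : Prop :=
  ∃ R ∈ C.display, ∃ J ∈ R, J.prems = [S] ∧ J.concl = S'

/-- Closure of the rules under simultaneous substitution of structures for congruent operational
terms occurring as `ρ`-parts, within each type. -/
def Calculus.ClosedUnderSubst (C : Calculus P Q) (ρ : Part) : Prop :=
  ∀ R ∈ C.allRules, ∀ J ∈ R, ∀ (l : Loc) (t : Ty) (a : Tm P Q t),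
    J.Parametric l → J.Occ l ρ (.tm a : Structure P Q t) → ∀ z : Structure P Q t,
      ∃ J' ∈ R, J'.prems = J.replacePrems l z ∧ J'.concl = J.replaceConcl l z

/-- Proper multi-type calculi. Conditions C₂, C₂', C₃, C₄, C₅', C₆', C₇' are imposed on all rules,
cuts included; C₁ is imposed on the rules other than cut. -/
structure Calculus.IsProper (C : Calculus P Q) : Prop where
  /-- C₁, preservation of operational terms. -/
  c1 : ∀ R ∈ C.rules, ∀ J ∈ R, ∀ S ∈ J.prems, ∀ a, S.HasTerm a →
    ∃ b, J.concl.HasTerm b ∧ Subterm a b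
  /-- C₂, shape-alikeness, and C₂', type-alikeness of parameters: congruent parameters are
  occurrences of one and the same structure, of one and the same type. -/
  c2 : ∀ R ∈ C.allRules, ∀ J ∈ R, ∀ l l', J.cong l l' →
    ∃ (t : Ty) (y : Structure P Q t), (∃ ρ, J.Occ l ρ y) ∧ ∃ ρ, J.Occ l' ρ y
  /-- C₃, non-proliferation of parameters. -/
  c3 : ∀ R ∈ C.allRules, ∀ J ∈ R, ∀ l o o', J.cong l (none, o) → J.cong l (none, o') → o = o'
  /-- C₄, position-alikeness of parameters. -/
  c4 : ∀ R ∈ C.allRules, ∀ J ∈ R, ∀ l l', J.cong l l' →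
    ∀ (t : Ty) (y : Structure P Q t) (ρ : Part) (t' : Ty) (y' : Structure P Q t') (ρ' : Part),
      J.Occ l ρ y → J.Occ l' ρ' y' → ρ = ρ'
  /-- C₅', quasi-display of principal constituents: in display, unless the rule has no premises. -/
  c5' : ∀ R ∈ C.allRules, ∀ J ∈ R, J.prems ≠ [] → ∀ o ρ t (a : Tm P Q t),
    J.Principal o ρ a → o.2 = []
  /-- C₅'', display-invariance of axioms. -/
  c5'' : ∀ R ∈ C.rules, ∀ J ∈ R, J.prems = [] → ∀ o ρ t (a : Tm P Q t), J.Principal o ρ a →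
    ∃ S, Relation.ReflTransGen C.DisplayStep J.concl S ∧ C.IsAxiom S ∧
      S.Occ (ρ, []) ρ (.tm a : Structure P Q t)
  /-- C₅''', closure of axioms under surgical cut. -/
  c5''' : ∀ (t : Ty) (a : Tm P Q t) (S : Sequent P Q) (o o' : Pos) (v z : Structure P Q t),
    C.IsAxiom S → S.Occ o pre (.tm a : Structure P Q t) →
    S.Occ o' suc (.tm a : Structure P Q t) →
    C.IsAxiom ⟨(.tm a : Structure P Q t), z⟩ →
    (∃ p, z.Occ suc p suc (.tm a : Structure P Q t)) →
    C.IsAxiom ⟨v, (.tm a : Structure P Q t)⟩ →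
    (∃ p, v.Occ pre p pre (.tm a : Structure P Q t)) →
      C.IsAxiom (S.replace z fun q => q = o') ∧ C.IsAxiom (S.replace v fun q => q = o)
  /-- C₆', closure under substitution for succedent parts within each type. -/
  c6' : C.ClosedUnderSubst suc
  /-- C₇', closure under substitution for precedent parts within each type. -/
  c7' : C.ClosedUnderSubst pre
  /-- C₈', eliminability of matching principal constituents: if the cut term has been introduced,
  as a principal term, by the last rule application above each premise of a cut, then the
  conclusion can be derived from the premises of these two applications by means of rules other than
  cut and of strongly type-uniform cuts on proper subterms of the cut term. -/
  c8' : ∀ R ∈ C.cuts, ∀ K ∈ R, ∀ R₁ ∈ C.rules, ∀ J₁ ∈ R₁, ∀ R₂ ∈ C.rules, ∀ J₂ ∈ R₂,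
    J₁.concl = K.left → J₁.Principal K.pos suc K.term →
    J₂.concl = K.right → J₂.Principal (pre, []) pre K.term →
      ∃ d : Derivation C {S | S ∈ J₁.prems ∨ S ∈ J₂.prems} K.concl,
        d.AllCuts fun K' =>
          K'.StronglyTypeUniform ∧ ProperSubterm ⟨K'.ty, K'.term⟩ ⟨K.ty, K.term⟩
  /-- C₉, type-uniformity of derivable sequents. -/
  c9 : ∀ S, C.Derivable S → S.TypeUniform
  /-- C₁₀, preservation of type-uniformity by the cut rules. -/
  c10 : ∀ R ∈ C.cuts, ∀ K ∈ R, K.left.TypeUniform → K.right.TypeUniform → K.concl.TypeUniform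

/-- Cut elimination: every derivable sequent has a cut-free derivation. -/
def Calculus.CutElimination (C : Calculus P Q) : Prop :=
  ∀ S, C.Derivable S → ∃ d : Derivation C ∅ S, d.CutFree

/-- Subformula property: cut-free derivations only contain subterms of the terms of their end
sequent, and every derivable sequent has such a derivation. -/
def Calculus.SubformulaProperty (C : Calculus P Q) : Prop :=
  (∀ S (d : Derivation C ∅ S), d.CutFree → d.Analytic) ∧
    ∀ S, C.Derivable S → ∃ d : Derivation C ∅ S, d.CutFree ∧ d.Analytic

end

/-! ### Rule schemas -/

/-- A rule schema: its structure variables stand for arbitrary structures of their type. -/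
structure Schema (P : Type u) (Q : Type v) : Type (max u v) where
  prems : List (Seq P Q ℕ)
  concl : Seq P Q ℕ

section
variable {P : Type u} {Q : Type v}

/-- The conclusion (`none`) or the `i`-th premise (`some i`). -/
def Schema.seq? (s : Schema P Q) : Option ℕ → Option (Seq P Q ℕ)
  | none => some s.concl
  | some i => s.prems[i]?

/-- In the instance of `s` by `σ`, location `l` lies inside an occurrence of the variable `n` of
type `t`, at address `r` of the structure `σ t n` substituted for it. -/
def Schema.InVar (s : Schema P Q) (σ : (t : Ty) → ℕ → Structure P Q t) (l : Loc) (t : Ty) (n : ℕ)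
    (r : Path) : Prop :=
  (∃ S q ρ, s.seq? l.1 = some S ∧ S.Occ (l.2.1, q) ρ (.var n : Str P Q ℕ t) ∧ l.2.2 = q ++ r) ∧
    ∃ (w : Ty) (y : Structure P Q w) (π ρ : Part), (σ t n).Occ π r ρ y

/-- The instance of a schema: two locations are congruent iff they are at the same address inside
the structures substituted for two occurrences of the same variable. -/
def Schema.inst (s : Schema P Q) (σ : (t : Ty) → ℕ → Structure P Q t) : Inference P Q where
  prems := s.prems.map (Seq.subst σ)
  concl := s.concl.subst σ
  cong l l' := ∃ t n r, s.InVar σ l t n r ∧ s.InVar σ l' t n r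

/-- The rule given by a family of schemas (indexed by the operational terms occurring in them). -/
def ruleOf {ι : Type*} (s : ι → Schema P Q) : Rule P Q := {J | ∃ i σ, J = (s i).inst σ}

/-- The rule given by a single schema. -/
def rule1 (s : Schema P Q) : Rule P Q := ruleOf fun _ : Unit => s

end

/-! ### The calculus D.LRC -/

section
variable (P : Type u) (Q : Type v)

local infix:50 " ⊢ₛ " => Seq.mk
local infixr:65 " ;ₛ " => Str.bin Bin.semi
local infixr:65 " >ₛ " => Str.bin Bin.gt
local infixr:65 " <ₛ " => Str.bin Bin.lt
/-- The structural comma of type `Res` is written `∙ₛ`. -/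
local infixr:65 " ∙ₛ " => Str.bin Bin.comma
local infixr:65 " ⊐ₛ " => Str.bin Bin.sqR
local infixr:65 " ⊏ₛ " => Str.bin Bin.sqL
local infixr:65 " ⊙ₛ " => Str.bin Bin.odot
local infixr:65 " ⋗ₛ " => Str.bin Bin.resR
local infixr:65 " ⋖ₛ " => Str.bin Bin.resL
local infixr:65 " ▷ₛ " => Str.bin Bin.tri
local infixr:65 " ▶ₛ " => Str.bin Bin.btri
local infixr:65 " ▷ᵣ " => Str.bin Bin.triR
local infixr:65 " ▶ᵣ " => Str.bin Bin.btriR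
local infixr:65 " ▲ᵣ " => Str.bin Bin.up
local notation "∘ₛ" => Str.un Un.circ
local notation "•ₛ" => Str.un Un.bull
local notation "∘ᵣ" => Str.un Un.circR
local notation "•ᵣ" => Str.un Un.bullR
local notation "τ" => Str.tm
local notation "I" => Str.nul Nul.I
local notation "Φ" => Str.nul Nul.Phi
local notation "X" => (Str.var 0 : Str _ _ ℕ Ty.fm)
local notation "Y" => (Str.var 1 : Str _ _ ℕ Ty.fm)
local notation "Z" => (Str.var 2 : Str _ _ ℕ Ty.fm)
local notation "W" => (Str.var 3 : Str _ _ ℕ Ty.fm)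
local notation "Γ" => (Str.var 0 : Str _ _ ℕ Ty.res)
local notation "Δ" => (Str.var 1 : Str _ _ ℕ Ty.res)
local notation "Ξ" => (Str.var 2 : Str _ _ ℕ Ty.res)
local notation "Ψ" => (Str.var 3 : Str _ _ ℕ Ty.res)

/-- The display postulates (double line: both directions). -/
def displayPairs : List (Seq P Q ℕ × Seq P Q ℕ) :=
  [ (X ;ₛ Y ⊢ₛ Z, Y ⊢ₛ X >ₛ Z),
    (Z ⊢ₛ X ;ₛ Y, X >ₛ Z ⊢ₛ Y),
    (X ;ₛ Y ⊢ₛ Z, X ⊢ₛ Z <ₛ Y),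
    (Z ⊢ₛ X ;ₛ Y, Z <ₛ Y ⊢ₛ X),
    (Γ ∙ₛ Δ ⊢ₛ Ξ, Δ ⊢ₛ Γ ⊐ₛ Ξ),
    (Γ ∙ₛ Δ ⊢ₛ Ξ, Γ ⊢ₛ Ξ ⊏ₛ Δ),
    (Γ ⊢ₛ Δ ∙ₛ Ξ, Δ ⊐ₛ Γ ⊢ₛ Ξ),
    (Γ ⊢ₛ Δ ∙ₛ Ξ, Γ ⊏ₛ Ξ ⊢ₛ Δ),
    (Γ ⊙ₛ Δ ⊢ₛ Ξ, Δ ⊢ₛ Γ ⋗ₛ Ξ),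
    (Γ ⊙ₛ Δ ⊢ₛ Ξ, Γ ⊢ₛ Ξ ⋖ₛ Δ),
    (∘ₛ X ⊢ₛ Y, X ⊢ₛ •ₛ Y),
    (∘ᵣ Γ ⊢ₛ X, Γ ⊢ₛ •ᵣ X),
    (X ⊢ₛ Γ ▷ₛ Y, Γ ⊢ₛ X ▶ₛ Y),
    (X ⊢ₛ Γ ▷ᵣ Δ, Γ ▲ᵣ X ⊢ₛ Δ),
    (X ⊢ₛ Γ ▷ᵣ Δ, Γ ⊢ₛ X ▶ᵣ Δ) ]

/-- The structural rules written with a double line. -/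
def structuralPairs : List (Seq P Q ℕ × Seq P Q ℕ) :=
  [ -- I_L, I_R, A_L, A_R of type Fm
    (X ⊢ₛ Y, I ;ₛ X ⊢ₛ Y),
    (Y ⊢ₛ X, Y ⊢ₛ X ;ₛ I),
    (X ;ₛ (Y ;ₛ Z) ⊢ₛ W, (X ;ₛ Y) ;ₛ Z ⊢ₛ W),
    (W ⊢ₛ (Z ;ₛ Y) ;ₛ X, W ⊢ₛ Z ;ₛ (Y ;ₛ X)),
    -- Φ_L1, Φ_L2, Φ_R, associativity of type Res
    (Γ ⊙ₛ Φ ⊢ₛ Δ, Γ ⊢ₛ Δ),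
    (Γ ⊢ₛ Δ, Φ ⊙ₛ Γ ⊢ₛ Δ),
    (Γ ⊢ₛ Δ, Γ ⊢ₛ Δ ∙ₛ Φ),
    (Γ ⊙ₛ (Δ ⊙ₛ Ξ) ⊢ₛ Ψ, (Γ ⊙ₛ Δ) ⊙ₛ Ξ ⊢ₛ Ψ),
    (Ξ ∙ₛ (Δ ∙ₛ Γ) ⊢ₛ Ψ, (Ξ ∙ₛ Δ) ∙ₛ Γ ⊢ₛ Ψ),
    (Ψ ⊢ₛ Ξ ∙ₛ (Δ ∙ₛ Γ), Ψ ⊢ₛ (Ξ ∙ₛ Δ) ∙ₛ Γ) ]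

/-- The one-premise structural rules written with a single line. -/
def structuralSingles : List (Seq P Q ℕ × Seq P Q ℕ) :=
  [ -- E_L, E_R, W_L, W_R, C_L, C_R of type Fm
    (Y ;ₛ X ⊢ₛ Z, X ;ₛ Y ⊢ₛ Z),
    (Z ⊢ₛ X ;ₛ Y, Z ⊢ₛ Y ;ₛ X),
    (Y ⊢ₛ Z, X ;ₛ Y ⊢ₛ Z),
    (Z ⊢ₛ Y, Z ⊢ₛ Y ;ₛ X),
    (X ;ₛ X ⊢ₛ Y, X ⊢ₛ Y),
    (Y ⊢ₛ X ;ₛ X, Y ⊢ₛ X),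
    -- W_Φ, and W_L, W_R, C_L, C_R, E_L, E_R, dis of type Res
    (Φ ⊢ₛ Δ, Γ ⊢ₛ Δ),
    (Γ ⊢ₛ Δ, Γ ∙ₛ Ξ ⊢ₛ Δ),
    (Γ ⊢ₛ Δ, Γ ⊢ₛ Δ ∙ₛ Ξ),
    (Γ ∙ₛ Γ ⊢ₛ Δ, Γ ⊢ₛ Δ),
    (Γ ⊢ₛ Δ ∙ₛ Δ, Γ ⊢ₛ Δ),
    (Γ ∙ₛ Δ ⊢ₛ Ξ, Δ ∙ₛ Γ ⊢ₛ Ξ),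
    (Ξ ⊢ₛ Γ ∙ₛ Δ, Ξ ⊢ₛ Δ ∙ₛ Γ),
    (Ψ ⊢ₛ (Γ ⋗ₛ Δ) ∙ₛ (Γ ⋗ₛ Ξ), Ψ ⊢ₛ Γ ⋗ₛ (Δ ∙ₛ Ξ)),
    -- D1, D3, D2, D4
    (X ⊢ₛ •ₛ Y ;ₛ •ₛ Z, X ⊢ₛ •ₛ (Y ;ₛ Z)),
    (Γ ⊢ₛ •ᵣ X ∙ₛ •ᵣ Y, Γ ⊢ₛ •ᵣ (X ;ₛ Y)),
    (X ⊢ₛ I, X ⊢ₛ •ₛ I),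
    (Γ ⊢ₛ Φ, Γ ⊢ₛ •ᵣ I),
    -- B4, B1, B6, B3, B7
    (Γ ⊢ₛ (Y ▶ᵣ Δ) ∙ₛ (Z ▶ᵣ Δ), Γ ⊢ₛ (Y ;ₛ Z) ▶ᵣ Δ),
    (Γ ⊢ₛ (Y ▶ₛ W) ∙ₛ (Z ▶ₛ W), Γ ⊢ₛ (Y ;ₛ Z) ▶ₛ W),
    ((Γ ▲ᵣ X) ∙ₛ (Γ ▲ᵣ Y) ⊢ₛ Δ, Γ ▲ᵣ (X ;ₛ Y) ⊢ₛ Δ),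
    (X ⊢ₛ Γ ▷ₛ (Δ ▷ₛ Y), X ⊢ₛ (Γ ⊙ₛ Δ) ▷ₛ Y),
    (Φ ⊢ₛ Δ, Γ ▲ᵣ I ⊢ₛ Δ),
    -- BD1, BD2
    (X ⊢ₛ Γ ▷ₛ •ₛ Y, X ⊢ₛ ∘ᵣ Γ >ₛ Y),
    (X ⊢ₛ Γ ▷ᵣ •ᵣ Y, X ⊢ₛ Γ ▷ₛ Y) ]

/-- The rule leading from one sequent to another. -/
def stepRule (s : Seq P Q ℕ × Seq P Q ℕ) : Rule P Q := rule1 ⟨[s.1], s.2⟩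

def displayRules : Set (Rule P Q) :=
  {R | ∃ s ∈ displayPairs P Q, R = stepRule P Q s ∨ R = stepRule P Q s.swap}

def structuralRules : Set (Rule P Q) :=
  {R | (∃ s ∈ structuralPairs P Q, R = stepRule P Q s ∨ R = stepRule P Q s.swap) ∨
    ∃ s ∈ structuralSingles P Q, R = stepRule P Q s}

/-- Identity axioms and introduction rules. -/
def logicalRules : Set (Rule P Q) :=
  { -- identity
    ruleOf fun p : P => ⟨[], τ (Tm.prop p) ⊢ₛ τ (Tm.prop p)⟩,
    ruleOf fun a : Q => ⟨[], τ (Tm.atom a) ⊢ₛ τ (Tm.atom a)⟩,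
    -- bottom and top
    rule1 ⟨[], τ Tm.bot ⊢ₛ I⟩,
    rule1 ⟨[X ⊢ₛ I], X ⊢ₛ τ Tm.bot⟩,
    rule1 ⟨[I ⊢ₛ X], τ Tm.top ⊢ₛ X⟩,
    rule1 ⟨[], I ⊢ₛ τ Tm.top⟩,
    -- conjunction, disjunction, implication
    ruleOf fun f : Tm P Q fm × Tm P Q fm => ⟨[τ f.1 ;ₛ τ f.2 ⊢ₛ X], τ (Tm.and f.1 f.2) ⊢ₛ X⟩,
    ruleOf fun f : Tm P Q fm × Tm P Q fm =>
      ⟨[X ⊢ₛ τ f.1, Y ⊢ₛ τ f.2], X ;ₛ Y ⊢ₛ τ (Tm.and f.1 f.2)⟩,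
    ruleOf fun f : Tm P Q fm × Tm P Q fm =>
      ⟨[τ f.1 ⊢ₛ X, τ f.2 ⊢ₛ Y], τ (Tm.or f.1 f.2) ⊢ₛ X ;ₛ Y⟩,
    ruleOf fun f : Tm P Q fm × Tm P Q fm => ⟨[X ⊢ₛ τ f.1 ;ₛ τ f.2], X ⊢ₛ τ (Tm.or f.1 f.2)⟩,
    ruleOf fun f : Tm P Q fm × Tm P Q fm =>
      ⟨[X ⊢ₛ τ f.1, τ f.2 ⊢ₛ Y], τ (Tm.imp f.1 f.2) ⊢ₛ X >ₛ Y⟩,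
    ruleOf fun f : Tm P Q fm × Tm P Q fm => ⟨[X ⊢ₛ τ f.1 >ₛ τ f.2], X ⊢ₛ τ (Tm.imp f.1 f.2)⟩,
    -- zero and one
    rule1 ⟨[], τ Tm.zero ⊢ₛ Φ⟩,
    rule1 ⟨[Γ ⊢ₛ Φ], Γ ⊢ₛ τ Tm.zero⟩,
    rule1 ⟨[Φ ⊢ₛ Γ], τ Tm.one ⊢ₛ Γ⟩,
    rule1 ⟨[], Φ ⊢ₛ τ Tm.one⟩,
    -- fusion, join, meet
    ruleOf fun f : Tm P Q res × Tm P Q res =>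
      ⟨[τ f.1 ⊙ₛ τ f.2 ⊢ₛ Γ], τ (Tm.fuse f.1 f.2) ⊢ₛ Γ⟩,
    ruleOf fun f : Tm P Q res × Tm P Q res =>
      ⟨[Γ ⊢ₛ τ f.1, Δ ⊢ₛ τ f.2], Γ ⊙ₛ Δ ⊢ₛ τ (Tm.fuse f.1 f.2)⟩,
    ruleOf fun f : Tm P Q res × Tm P Q res =>
      ⟨[τ f.1 ⊢ₛ Γ, τ f.2 ⊢ₛ Δ], τ (Tm.join f.1 f.2) ⊢ₛ Γ ∙ₛ Δ⟩,
    ruleOf fun f : Tm P Q res × Tm P Q res =>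
      ⟨[Γ ⊢ₛ τ f.1 ∙ₛ τ f.2], Γ ⊢ₛ τ (Tm.join f.1 f.2)⟩,
    ruleOf fun f : Tm P Q res × Tm P Q res =>
      ⟨[τ f.1 ∙ₛ τ f.2 ⊢ₛ Γ], τ (Tm.meet f.1 f.2) ⊢ₛ Γ⟩,
    ruleOf fun f : Tm P Q res × Tm P Q res =>
      ⟨[Γ ⊢ₛ τ f.1, Δ ⊢ₛ τ f.2], Γ ∙ₛ Δ ⊢ₛ τ (Tm.meet f.1 f.2)⟩,
    -- modal operators
    ruleOf fun A : Tm P Q fm => ⟨[∘ₛ (τ A) ⊢ₛ X], τ (Tm.dia A) ⊢ₛ X⟩,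
    ruleOf fun A : Tm P Q fm => ⟨[X ⊢ₛ τ A], ∘ₛ X ⊢ₛ τ (Tm.dia A)⟩,
    ruleOf fun f : Tm P Q res × Tm P Q fm =>
      ⟨[Γ ⊢ₛ τ f.1, τ f.2 ⊢ₛ X], τ (Tm.cap f.1 f.2) ⊢ₛ Γ ▷ₛ X⟩,
    ruleOf fun f : Tm P Q res × Tm P Q fm => ⟨[X ⊢ₛ τ f.1 ▷ₛ τ f.2], X ⊢ₛ τ (Tm.cap f.1 f.2)⟩,
    ruleOf fun α : Tm P Q res => ⟨[∘ᵣ (τ α) ⊢ₛ X], τ (Tm.poss α) ⊢ₛ X⟩,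
    ruleOf fun α : Tm P Q res => ⟨[Γ ⊢ₛ τ α], ∘ᵣ Γ ⊢ₛ τ (Tm.poss α)⟩,
    ruleOf fun f : Tm P Q res × Tm P Q res =>
      ⟨[Γ ⊢ₛ τ f.1, τ f.2 ⊢ₛ Δ], τ (Tm.get f.1 f.2) ⊢ₛ Γ ▷ᵣ Δ⟩,
    ruleOf fun f : Tm P Q res × Tm P Q res =>
      ⟨[X ⊢ₛ τ f.1 ▷ᵣ τ f.2], X ⊢ₛ τ (Tm.get f.1 f.2)⟩ }

/-- The surgical cut on formulas: `(X ⊢ Y)[A]^suc`, `A ⊢ Z` / `(X ⊢ Y)[Z/A]^suc`. -/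
def fmCut : Set (Cut P Q) := {K | K.ty = fm ∧ K.left.lty = fm ∧ K.left.rty = fm}

/-- The cut on resources: `Γ ⊢ α`, `α ⊢ Δ` / `Γ ⊢ Δ`. -/
def resCut : Set (Cut P Q) :=
  {K | K.ty = res ∧ K.left.lty = res ∧ K.left.rty = res ∧ K.pos = (suc, [])}

/-- The calculus D.LRC over atomic propositions `P` and atomic resources `Q`. -/
def calculus : Calculus P Q where
  rules := displayRules P Q ∪ structuralRules P Q ∪ logicalRules P Q
  display := displayRules P Q
  display_subset := fun _ h => Or.inl (Or.inl h)
  cuts := {fmCut P Q, resCut P Q}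

end

end DLRC

namespace DLRC

universe u v

open Ty

open _root_.DLRC.Part

/-! ### Addresses, parts and substructures. -/

section
variable {P : Type u} {Q : Type v} {V W : Type}

/-! Properness is mostly a matter of syntax. Every rule other than cut is given by a family of
schemas, and `Schema.Good` collects what one inspects in a schema: the conclusion is type-uniform
and contains no variable twice, each variable of a premise recurs in the conclusion as the same kind
of part, a term of the conclusion is a whole side, and each term of a premise is an immediate
subterm of one in the conclusion. For instances of such a schema, the conditions on parameters and
principal terms follow from one fact: a location lies in at most one variable, at one inner address
(`Schema.InVar.unique`). For cuts the same role is played by `Cut.Trace`, which labels each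
parameter by its address in the conclusion.

For principal cuts, `derivableBy_of_intro` displays the immediate subterms one after the other, cuts
on them and undoes the display. The exception is the second coordinate of the structural triangle
`▷`, which no postulate displays; there the surgical cut on formulas acts in place.

Cut elimination is the admissibility of a more general operation: if `b ⊢ z` and `S` have cut-free
proofs, then so has every sequent obtained from `S` by putting `z` for any number of succedent
occurrences of `b`. Many occurrences must be allowed, because contraction read upwards duplicates
them. By linearity of the conclusion, a replacement in the conclusion of a rule comes from a
replacement in the premises, unless it hits the principal term (`Schema.Good.exists_inst_of_repl`).
So one climbs the proof of `S` to the places where `b` is introduced on the right, and from each of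
them climbs the proof of `b ⊢ z` to the places where `b` is introduced on the left
(`prov_of_repl_pre`). There the cut is principal and reduces to cuts on proper subterms, which are
admissible by induction on size (`prov_of_repl_suc`).

The subformula property follows because rules other than cut lose no terms from premises to
conclusion. Type-uniformity of derivable sequents is read off the last rule of a cut-free proof. -/

/-- The substructure at an address, together with its part. -/
def Str.sub : {t : Ty} → Part → Str P Q V t → Path → Option (Part × Σ w, Str P Q V w)
  | _, π, x, [] => some (π, ⟨_, x⟩)
  | _, π, .un _ x, .fst :: p => x.sub π p
  | _, π, .bin c x _, .fst :: p => x.sub (c.fstPart π) p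
  | _, π, .bin c _ y, .snd :: p => y.sub (c.sndPart π) p
  | _, _, _, _ :: _ => none

@[simp] theorem Str.sub_nil {t : Ty} (π : Part) (x : Str P Q V t) :
    x.sub π [] = some (π, ⟨t, x⟩) := by
  cases x <;> rfl

@[simp] theorem Str.sub_un_fst {s t : Ty} (π : Part) (c : Un s t) (x : Str P Q V s) (p : Path) :
    (Str.un c x).sub π (.fst :: p) = x.sub π p := rfl

@[simp] theorem Str.sub_un_snd {s t : Ty} (π : Part) (c : Un s t) (x : Str P Q V s) (p : Path) :
    (Str.un c x).sub π (.snd :: p) = none := rfl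

@[simp] theorem Str.sub_bin_fst {s t w : Ty} (π : Part) (c : Bin s t w) (x : Str P Q V s)
    (y : Str P Q V t) (p : Path) : (Str.bin c x y).sub π (.fst :: p) = x.sub (c.fstPart π) p := rfl

@[simp] theorem Str.sub_bin_snd {s t w : Ty} (π : Part) (c : Bin s t w) (x : Str P Q V s)
    (y : Str P Q V t) (p : Path) : (Str.bin c x y).sub π (.snd :: p) = y.sub (c.sndPart π) p := rfl

@[simp] theorem Str.sub_var_cons {t : Ty} (π : Part) (n : V) (d : Dir) (p : Path) :
    (Str.var n : Str P Q V t).sub π (d :: p) = none := by cases d <;> rfl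

@[simp] theorem Str.sub_tm_cons {t : Ty} (π : Part) (a : Tm P Q t) (d : Dir) (p : Path) :
    (Str.tm a : Str P Q V t).sub π (d :: p) = none := by cases d <;> rfl

@[simp] theorem Str.sub_nul_cons {t : Ty} (π : Part) (c : Nul t) (d : Dir) (p : Path) :
    (Str.nul c : Str P Q V t).sub π (d :: p) = none := by cases d <;> rfl

/-- Replaces the inductive relation by the value of a function, so that uniqueness of the part and
of the structure at an address is injectivity of `some`. -/
theorem Str.occ_iff {t w : Ty} {π ρ : Part} {x : Str P Q V t} {p : Path} {y : Str P Q V w} :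
    x.Occ π p ρ y ↔ x.sub π p = some (ρ, ⟨w, y⟩) := by
  constructor
  · intro h
    induction h with
    | here x => simp
    | un c _ ih => simpa using ih
    | fst c _ ih => simpa using ih
    | snd c _ ih => simpa using ih
  · intro h
    induction x generalizing π p with
    | var n =>
      rcases p with _ | ⟨d, p⟩
      · simp at h; obtain ⟨rfl, rfl, h⟩ := h; cases h; exact .here _
      · simp at h
    | tm n =>
      rcases p with _ | ⟨d, p⟩
      · simp at h; obtain ⟨rfl, rfl, h⟩ := h; cases h; exact .here _
      · simp at h
    | nul n =>
      rcases p with _ | ⟨d, p⟩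
      · simp at h; obtain ⟨rfl, rfl, h⟩ := h; cases h; exact .here _
      · simp at h
    | un c x ih =>
      rcases p with _ | ⟨_ | _, p⟩
      · simp at h; obtain ⟨rfl, rfl, h⟩ := h; cases h; exact .here _
      · exact .un _ (ih h)
      · simp at h
    | bin c x y ihx ihy =>
      rcases p with _ | ⟨_ | _, p⟩
      · simp at h; obtain ⟨rfl, rfl, h⟩ := h; cases h; exact .here _
      · exact .fst _ (ihx h)
      · exact .snd _ (ihy h)

theorem Str.sub_append {t : Ty} (π : Part) (x : Str P Q V t) (p q : Path) :
    x.sub π (p ++ q) = (x.sub π p).bind fun u => u.2.2.sub u.1 q := by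
  induction x generalizing π p with
  | var n => rcases p with _ | ⟨d, p⟩ <;> simp
  | tm n => rcases p with _ | ⟨d, p⟩ <;> simp
  | nul n => rcases p with _ | ⟨d, p⟩ <;> simp
  | un c x ih => rcases p with _ | ⟨_ | _, p⟩ <;> simp [ih]
  | bin c x y ihx ihy => rcases p with _ | ⟨_ | _, p⟩ <;> simp [ihx, ihy]

/-- The substructure at an address does not depend on the part assigned to the root. -/
theorem Str.sub_part {t : Ty} {π : Part} (π' : Part) {x : Str P Q V t} {p : Path} {ρ : Part}
    {y : Σ w, Str P Q V w} (h : x.sub π p = some (ρ, y)) : ∃ ρ', x.sub π' p = some (ρ', y) := by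
  induction x generalizing π π' p with
  | var n => rcases p with _ | ⟨d, p⟩ <;> simp_all
  | tm n => rcases p with _ | ⟨d, p⟩ <;> simp_all
  | nul n => rcases p with _ | ⟨d, p⟩ <;> simp_all
  | un c x ih =>
    rcases p with _ | ⟨_ | _, p⟩
    · simp_all
    · exact ih π' h
    · simp at h
  | bin c x y ihx ihy =>
    rcases p with _ | ⟨_ | _, p⟩
    · simp_all
    · exact ihx _ h
    · exact ihy _ h

/-- A structure without proper substructures. -/
def Str.Leaf {t : Ty} (x : Str P Q V t) : Prop := ∀ π d p, x.sub π (d :: p) = none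

theorem Str.leaf_tm {t : Ty} (a : Tm P Q t) : (Str.tm a : Str P Q V t).Leaf := by
  intro; simp

theorem Str.leaf_var {t : Ty} (n : V) : (Str.var n : Str P Q V t).Leaf := by
  intro; simp

/-- Used whenever two addresses are comparable and the shorter one carries a term or a variable: the
addresses must then coincide. -/
theorem Str.sub_leaf {t : Ty} {π : Part} {x : Str P Q V t} {p r : Path} {ρ : Part}
    {y : Σ w, Str P Q V w} {u} (h : x.sub π p = some (ρ, y)) (hy : y.2.Leaf)
    (h' : x.sub π (p ++ r) = some u) : r = [] := by
  rw [Str.sub_append, h] at h'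
  rcases r with _ | ⟨d, r⟩
  · rfl
  · simp [hy _ _ _] at h'

/-- The substructure at an address of a sequent. -/
def Seq.sub (S : Seq P Q V) (o : Pos) : Option (Part × Σ w, Str P Q V w) :=
  match o.1 with
  | pre => S.ante.sub pre o.2
  | suc => S.cons.sub suc o.2

@[simp] theorem Seq.sub_pre (S : Seq P Q V) (p : Path) : S.sub (pre, p) = S.ante.sub pre p := rfl

@[simp] theorem Seq.sub_suc (S : Seq P Q V) (p : Path) : S.sub (suc, p) = S.cons.sub suc p := rfl

theorem Seq.occ_iff {S : Seq P Q V} {o : Pos} {ρ : Part} {w : Ty} {y : Str P Q V w} :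
    S.Occ o ρ y ↔ S.sub o = some (ρ, ⟨w, y⟩) := by
  obtain ⟨_ | _, p⟩ := o <;> exact Str.occ_iff

theorem Seq.sub_append (S : Seq P Q V) (π : Part) (p q : Path) :
    S.sub (π, p ++ q) = (S.sub (π, p)).bind fun u => u.2.2.sub u.1 q := by
  cases π <;> exact Str.sub_append _ _ _ _

theorem Seq.sub_leaf {S : Seq P Q V} {π : Part} {p r : Path} {ρ : Part}
    {y : Σ w, Str P Q V w} {u} (h : S.sub (π, p) = some (ρ, y)) (hy : y.2.Leaf)
    (h' : S.sub (π, p ++ r) = some u) : r = [] := by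
  cases π
  · exact Str.sub_leaf h hy h'
  · exact Str.sub_leaf h hy h'

/-! ### Replacement -/

@[simp] theorem Str.replace_nil {t : Ty} (z x : Str P Q V t) {at' : Path → Prop} (h : at' []) :
    Str.replace z x at' = z := by
  cases x <;> simp [Str.replace, graft, h]

theorem Str.replace_un {s t w : Ty} (z : Str P Q V w) (c : Un s t) (x : Str P Q V s)
    {at' : Path → Prop} (h : ¬ at' []) : Str.replace z (.un c x) at' =
      .un c (Str.replace z x fun p => at' (.fst :: p)) := by
  simp [Str.replace, graft, h]

theorem Str.replace_bin {s t k w : Ty} (z : Str P Q V w) (c : Bin s t k) (x : Str P Q V s)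
    (y : Str P Q V t) {at' : Path → Prop} (h : ¬ at' []) : Str.replace z (.bin c x y) at' =
      .bin c (Str.replace z x fun p => at' (.fst :: p))
        (Str.replace z y fun p => at' (.snd :: p)) := by
  simp [Str.replace, graft, h]

/-- Replacement consults its address predicate only at occupied addresses. The congruence relation
of an inference can thus be exchanged for a simpler predicate that agrees with it there. -/
theorem Str.replace_congr {t w : Ty} (z : Str P Q V w) (x : Str P Q V t) {f g : Path → Prop}
    (h : ∀ p π u, x.sub π p = some u → (f p ↔ g p)) : Str.replace z x f = Str.replace z x g := by
  induction x generalizing f g with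
  | un c x ih =>
    have h0 := h [] pre _ (by simp; rfl)
    simp only [Str.replace, h0]
    rw [ih fun p π u hp => h (.fst :: p) π u hp]
  | bin c x y ihx ihy =>
    have h0 := h [] pre _ (by simp; rfl)
    simp only [Str.replace, h0]
    have e1 := ihx (f := fun p => f (.fst :: p)) (g := fun p => g (.fst :: p)) fun p π u hp => by
      obtain ⟨ρ, hρ⟩ := Str.sub_part (c.fstPart pre) hp
      exact h (.fst :: p) pre _ hρ
    have e2 := ihy (f := fun p => f (.snd :: p)) (g := fun p => g (.snd :: p)) fun p π u hp => by
      obtain ⟨ρ, hρ⟩ := Str.sub_part (c.sndPart pre) hp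
      exact h (.snd :: p) pre _ hρ
    rw [e1, e2]
  | _ =>
    have h0 := h [] pre _ (by simp; rfl)
    simp only [Str.replace, h0]

theorem Str.replace_false {t w : Ty} (z : Str P Q V w) (x : Str P Q V t) :
    (Str.replace z x fun _ => False) = x := by
  induction x with
  | un c x ih => simp [Str.replace_un, ih]
  | bin c x y ihx ihy => simp [Str.replace_bin, ihx, ihy]
  | _ => simp [Str.replace, graft]

theorem Str.replace_not {t w : Ty} (z : Str P Q V w) (x : Str P Q V t) {f : Path → Prop}
    (h : ∀ p π u, x.sub π p = some u → ¬ f p) : Str.replace z x f = x := by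
  -- The three rewrites leave the left side as it was and turn the right side into a replacement at
  -- no address, so that `Str.replace_congr` applies.
  rw [← Str.replace_false z x]
  conv_rhs => rw [← Str.replace_false z x]
  rw [Str.replace_false z x]
  exact Str.replace_congr z x fun p π u hp => by simp [h p π u hp]

theorem Seq.replace_congr {w : Ty} (z : Str P Q V w) (S : Seq P Q V) {f g : Pos → Prop}
    (h : ∀ o u, S.sub o = some u → (f o ↔ g o)) : Seq.replace z S f = Seq.replace z S g := by
  unfold Seq.replace
  congr 1
  · refine Str.replace_congr _ _ fun p π u hp => ?_
    obtain ⟨ρ, hρ⟩ := Str.sub_part pre hp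
    exact h (pre, p) _ hρ
  · refine Str.replace_congr _ _ fun p π u hp => ?_
    obtain ⟨ρ, hρ⟩ := Str.sub_part suc hp
    exact h (suc, p) _ hρ

theorem Seq.replace_not {w : Ty} (z : Str P Q V w) (S : Seq P Q V) {f : Pos → Prop}
    (h : ∀ o u, S.sub o = some u → ¬ f o) : Seq.replace z S f = S := by
  rw [Seq.replace_congr z S (g := fun _ => False) fun o u ho => by simp [h o u ho]]
  simp [Seq.replace, Str.replace_false]

section single
variable {t w : Ty} {π κ : Part} {x : Str P Q V t} {p : Path} {a : Tm P Q w} {z : Str P Q V w}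

/-- This lemma and the next two describe the result of one replacement at every address: at or below
`p`, incomparable with `p`, and strictly above `p`. -/
theorem Str.sub_replace_below (h : x.sub π p = some (κ, ⟨w, .tm a⟩)) (r : Path) :
    (Str.replace z x fun q => q = p).sub π (p ++ r) = z.sub κ r := by
  induction x generalizing π p with
  | un c x ih =>
    rcases p with _ | ⟨_ | _, p⟩
    · simp at h; obtain ⟨_, rfl, h⟩ := h; cases h
    · simpa [Str.replace_un] using ih h
    · simp at h
  | bin c x y ihx ihy =>
    rcases p with _ | ⟨_ | _, p⟩
    · simp at h; obtain ⟨_, rfl, h⟩ := h; cases h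
    · simpa [Str.replace_bin] using ihx h
    · simpa [Str.replace_bin] using ihy h
  | _ =>
    rcases p with _ | ⟨_, p⟩
    · simp at h; obtain ⟨rfl, rfl, h⟩ := h; simp
    · simp at h

theorem Str.sub_replace_off (h : x.sub π p = some (κ, ⟨w, .tm a⟩)) {q : Path} (h1 : ¬ q <+: p)
    (h2 : ¬ p <+: q) : (Str.replace z x fun q => q = p).sub π q = x.sub π q := by
  induction x generalizing π p q with
  | un c x ih =>
    rcases p with _ | ⟨_ | _, p⟩
    · simp at h2
    · rw [Str.replace_un _ _ _ (by simp)]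
      rcases q with _ | ⟨_ | _, q⟩
      · simp at h1
      · simpa using ih h (by simpa using h1) (by simpa using h2)
      · simp
    · simp at h
  | bin c x y ihx ihy =>
    rcases p with _ | ⟨_ | _, p⟩
    · simp at h2
    · rw [Str.replace_bin _ _ _ _ (by simp)]
      rcases q with _ | ⟨_ | _, q⟩
      · simp at h1
      · simpa using ihx h (by simpa using h1) (by simpa using h2)
      · simp [Str.replace_false]
    · rw [Str.replace_bin _ _ _ _ (by simp)]
      rcases q with _ | ⟨_ | _, q⟩
      · simp at h1
      · simp [Str.replace_false]
      · simpa using ihy h (by simpa using h1) (by simpa using h2)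
  | _ =>
    rcases p with _ | ⟨_, p⟩
    · simp at h2
    · simp at h

/-- A structure strictly above the replaced term is built by a connective, before and after the
replacement. Hence no term of the conclusion of a cut sits on the path to the cut address. -/
theorem Str.sub_replace_above (h : x.sub π p = some (κ, ⟨w, .tm a⟩)) {q : Path} (h1 : q <+: p)
    (h2 : q ≠ p) {ρ : Part} {k : Ty} (b : Tm P Q k) :
    (Str.replace z x fun q => q = p).sub π q ≠ some (ρ, ⟨k, .tm b⟩) := by
  induction x generalizing π p q with
  | un c x ih =>
    rcases p with _ | ⟨_ | _, p⟩
    · simp at h; obtain ⟨_, rfl, h⟩ := h; cases h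
    · rw [Str.replace_un _ _ _ (by simp)]
      rcases q with _ | ⟨_ | _, q⟩
      · simp; rintro _ rfl h; cases h
      · simpa using ih h (by simpa using h1) (by simpa using h2)
      · simp
    · simp at h
  | bin c x y ihx ihy =>
    rcases p with _ | ⟨_ | _, p⟩
    · simp at h; obtain ⟨_, rfl, h⟩ := h; cases h
    · rw [Str.replace_bin _ _ _ _ (by simp)]
      rcases q with _ | ⟨_ | _, q⟩
      · simp; rintro _ rfl h; cases h
      · simpa using ihx h (by simpa using h1) (by simpa using h2)
      · simp at h1
    · rw [Str.replace_bin _ _ _ _ (by simp)]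
      rcases q with _ | ⟨_ | _, q⟩
      · simp; rintro _ rfl h; cases h
      · simp at h1
      · simpa using ihy h (by simpa using h1) (by simpa using h2)
  | _ =>
    rcases p with _ | ⟨_, p⟩
    · simp_all
    · simp at h

theorem Str.replace_self (h : x.sub π p = some (κ, ⟨w, .tm a⟩)) :
    (Str.replace (.tm a : Str P Q V w) x fun q => q = p) = x := by
  induction x generalizing π p with
  | un c x ih =>
    rcases p with _ | ⟨_ | _, p⟩
    · simp at h; obtain ⟨_, rfl, h⟩ := h; cases h
    · simpa [Str.replace_un] using ih h
    · simp at h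
  | bin c x y ihx ihy =>
    rcases p with _ | ⟨_ | _, p⟩
    · simp at h; obtain ⟨_, rfl, h⟩ := h; cases h
    · simpa [Str.replace_bin, Str.replace_false] using ihx h
    · simpa [Str.replace_bin, Str.replace_false] using ihy h
  | _ =>
    rcases p with _ | ⟨_, p⟩
    · simp at h; obtain ⟨rfl, rfl, h⟩ := h; cases h <;> simp
    · simp at h

/-- Replacing inside a replacement. -/
theorem Str.replace_below (h : x.sub π p = some (κ, ⟨w, .tm a⟩)) {k : Ty} (z' : Str P Q V k)
    (f : Path → Prop) :
    (Str.replace z' (Str.replace z x fun q => q = p) fun q => ∃ r, q = p ++ r ∧ f r) =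
      Str.replace (Str.replace z' z f) x fun q => q = p := by
  induction x generalizing π p with
  | un c x ih =>
    rcases p with _ | ⟨_ | _, p⟩
    · simp at h; obtain ⟨_, rfl, h⟩ := h; cases h
    · simpa [Str.replace_un] using ih h
    · simp at h
  | bin c x y ihx ihy =>
    rcases p with _ | ⟨_ | _, p⟩
    · simp at h; obtain ⟨_, rfl, h⟩ := h; cases h
    · simpa [Str.replace_bin, Str.replace_false] using ihx h
    · simpa [Str.replace_bin, Str.replace_false] using ihy h
  | _ =>
    rcases p with _ | ⟨_, p⟩
    · simp at h; obtain ⟨rfl, rfl, h⟩ := h; simp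
    · simp at h

/-- Replacements of two different terms commute. -/
theorem Str.replace_comm (h : x.sub π p = some (κ, ⟨w, .tm a⟩)) {q : Path} {k : Ty}
    {ρ : Part} {b : Tm P Q k} (h' : x.sub π q = some (ρ, ⟨k, .tm b⟩)) (hpq : p ≠ q)
    (z' : Str P Q V k) :
    (Str.replace z' (Str.replace z x fun r => r = p) fun r => r = q) =
      Str.replace z (Str.replace z' x fun r => r = q) fun r => r = p := by
  induction x generalizing π p q with
  | un c x ih =>
    rcases p with _ | ⟨_ | _, p⟩
    · simp at h; obtain ⟨_, rfl, h⟩ := h; cases h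
    · rcases q with _ | ⟨_ | _, q⟩
      · simp at h'; obtain ⟨_, rfl, h'⟩ := h'; cases h'
      · simpa [Str.replace_un] using ih h h' (by simpa using hpq)
      · simp at h'
    · simp at h
  | bin c x y ihx ihy =>
    rcases p with _ | ⟨_ | _, p⟩
    · simp at h; obtain ⟨_, rfl, h⟩ := h; cases h
    · rcases q with _ | ⟨_ | _, q⟩
      · simp at h'; obtain ⟨_, rfl, h'⟩ := h'; cases h'
      · simpa [Str.replace_bin, Str.replace_false] using ihx h h' (by simpa using hpq)
      · simp [Str.replace_bin, Str.replace_false]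
    · rcases q with _ | ⟨_ | _, q⟩
      · simp at h'; obtain ⟨_, rfl, h'⟩ := h'; cases h'
      · simp [Str.replace_bin, Str.replace_false]
      · simpa [Str.replace_bin, Str.replace_false] using ihy h h' (by simpa using hpq)
  | _ =>
    rcases p with _ | ⟨_, p⟩
    · rcases q with _ | ⟨_, q⟩
      · simp at hpq
      · simp at h'
    · simp at h

end single

theorem Seq.replace_pre {w : Ty} (z : Str P Q V w) (S : Seq P Q V) (p : Path) :
    (S.replace z fun o => o = (pre, p)) = ⟨Str.replace z S.ante fun q => q = p, S.cons⟩ := by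
  simp [Seq.replace, Str.replace_false]

theorem Seq.replace_suc {w : Ty} (z : Str P Q V w) (S : Seq P Q V) (p : Path) :
    (S.replace z fun o => o = (suc, p)) = ⟨S.ante, Str.replace z S.cons fun q => q = p⟩ := by
  simp [Seq.replace, Str.replace_false]

section single
variable {w : Ty} {κ π : Part} {S : Seq P Q V} {p : Path} {a : Tm P Q w} {z : Str P Q V w}

theorem Seq.sub_replace_below (h : S.sub (π, p) = some (κ, ⟨w, .tm a⟩)) (r : Path) :
    (S.replace z fun o => o = (π, p)).sub (π, p ++ r) = z.sub κ r := by
  cases π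
  · simpa [Seq.replace_pre] using Str.sub_replace_below h r
  · simpa [Seq.replace_suc] using Str.sub_replace_below h r

theorem Seq.sub_replace_off (h : S.sub (π, p) = some (κ, ⟨w, .tm a⟩)) {o : Pos}
    (h1 : ¬ (o.1 = π ∧ o.2 <+: p)) (h2 : ¬ (o.1 = π ∧ p <+: o.2)) :
    (S.replace z fun o => o = (π, p)).sub o = S.sub o := by
  obtain ⟨_ | _, q⟩ := o <;> cases π
  · simpa [Seq.replace_pre] using Str.sub_replace_off h (by simpa using h1) (by simpa using h2)
  · simp [Seq.replace_suc]
  · simp [Seq.replace_pre]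
  · simpa [Seq.replace_suc] using Str.sub_replace_off h (by simpa using h1) (by simpa using h2)

theorem Seq.sub_replace_above (h : S.sub (π, p) = some (κ, ⟨w, .tm a⟩)) {q : Path}
    (h1 : q <+: p) (h2 : q ≠ p) {ρ : Part} {k : Ty} (b : Tm P Q k) :
    (S.replace z fun o => o = (π, p)).sub (π, q) ≠ some (ρ, ⟨k, .tm b⟩) := by
  cases π
  · simpa [Seq.replace_pre] using Str.sub_replace_above h h1 h2 b
  · simpa [Seq.replace_suc] using Str.sub_replace_above h h1 h2 b

theorem Seq.replace_self (h : S.sub (π, p) = some (κ, ⟨w, .tm a⟩)) :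
    (S.replace (.tm a : Str P Q V w) fun o => o = (π, p)) = S := by
  cases π
  · simp only [Seq.replace_pre, Str.replace_self h]
  · simp only [Seq.replace_suc, Str.replace_self h]

theorem Seq.replace_below (h : S.sub (π, p) = some (κ, ⟨w, .tm a⟩)) {k : Ty}
    (z' : Str P Q V k) (q : Path) :
    ((S.replace z fun o => o = (π, p)).replace z' fun o => o = (π, p ++ q)) =
      S.replace (Str.replace z' z fun r => r = q) fun o => o = (π, p) := by
  have e : (fun r => r = p ++ q) = fun r => ∃ s, r = p ++ s ∧ s = q := by
    funext r; simp
  cases π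
  · simp only [Seq.replace_pre, e, Str.replace_below h]
  · simp only [Seq.replace_suc, e, Str.replace_below h]

theorem Seq.replace_comm (h : S.sub (π, p) = some (κ, ⟨w, .tm a⟩)) {o : Pos} {k : Ty}
    {ρ : Part} {b : Tm P Q k} (h' : S.sub o = some (ρ, ⟨k, .tm b⟩)) (hpo : o ≠ (π, p))
    (z' : Str P Q V k) :
    ((S.replace z fun r => r = (π, p)).replace z' fun r => r = o) =
      (S.replace z' fun r => r = o).replace z fun r => r = (π, p) := by
  obtain ⟨_ | _, q⟩ := o <;> cases π
  · simp only [Seq.replace_pre]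
    rw [Str.replace_comm h h' (by rintro rfl; exact hpo rfl)]
  · simp only [Seq.replace_suc, Seq.replace_pre]
  · simp only [Seq.replace_suc, Seq.replace_pre]
  · simp only [Seq.replace_suc]
    rw [Str.replace_comm h h' (by rintro rfl; exact hpo rfl)]

end single
end

/-! ### The parameters of a cut. -/

section
variable {P : Type u} {Q : Type v}

theorem Cut.sub_pos (K : Cut P Q) :
    K.left.sub K.pos = some (suc, ⟨K.ty, .tm K.term⟩) := Seq.occ_iff.1 K.occ

/-- A part of the left premise of a cut off the spine is not below the cut term. -/
theorem Cut.not_below {K : Cut P Q} {o : Pos} {u} (h : K.left.sub o = some u)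
    (ho : ¬ K.OnSpine o) : ¬ (o.1 = K.pos.1 ∧ K.pos.2 <+: o.2) := by
  rintro ⟨h1, r, h2⟩
  obtain ⟨π, q⟩ := o
  subst h1
  simp only at h2
  subst h2
  obtain rfl := Seq.sub_leaf K.sub_pos (Str.leaf_tm _) h
  exact ho ⟨rfl, by simp⟩

theorem Cut.sub_concl_left {K : Cut P Q} {o : Pos} {u} (h : K.left.sub o = some u)
    (ho : ¬ K.OnSpine o) : K.concl.sub o = some u :=
  (Seq.sub_replace_off K.sub_pos ho (Cut.not_below h ho)).trans h

theorem Cut.sub_concl_right (K : Cut P Q) (p : Path) :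
    K.concl.sub (K.pos.1, K.pos.2 ++ p) = K.z.sub suc p :=
  Seq.sub_replace_below K.sub_pos p

/-- The part and the structure found in the conclusion of a cut at the address of a parameter
are those found at the location of that parameter. -/
theorem Cut.Trace.occ_iff {K : Cut P Q} {l : Loc} {o : Pos} (h : K.Trace l o) {ρ : Part} {w : Ty}
    (y : Structure P Q w) : K.toInference.Occ l ρ y ↔ K.concl.sub o = some (ρ, ⟨w, y⟩) := by
  cases h with
  | left h ho =>
    have h := Seq.occ_iff.1 h
    rw [Cut.sub_concl_left h ho, ← h, ← Seq.occ_iff]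
    simp [Inference.Occ, Cut.toInference]
  | right h =>
    rw [Cut.sub_concl_right, ← Str.occ_iff]
    simp [Inference.Occ, Cut.toInference, Cut.right, Seq.Occ]
  | conclLeft h ho => exact Seq.occ_iff
  | conclRight h => exact Seq.occ_iff

theorem Cut.Trace.exists_occ {K : Cut P Q} {l : Loc} {o : Pos} (h : K.Trace l o) :
    ∃ (ρ : Part) (w : Ty) (y : Structure P Q w), K.concl.sub o = some (ρ, ⟨w, y⟩) := by
  cases h with
  | left h ho => exact ⟨_, _, _, Cut.sub_concl_left (Seq.occ_iff.1 h) ho⟩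
  | right h => exact ⟨_, _, _, (Cut.sub_concl_right K _).trans (Str.occ_iff.1 h)⟩
  | conclLeft h ho => exact ⟨_, _, _, Cut.sub_concl_left (Seq.occ_iff.1 h) ho⟩
  | conclRight h => exact ⟨_, _, _, (Cut.sub_concl_right K _).trans (Str.occ_iff.1 h)⟩

theorem Cut.Trace.unique {K : Cut P Q} {l : Loc} {o o' : Pos} (h : K.Trace l o)
    (h' : K.Trace l o') : o = o' := by
  generalize hl : l = m at h'
  cases h <;> cases h' <;> simp_all

theorem Cut.trace_none {K : Cut P Q} {o o' : Pos} (h : K.Trace (none, o) o') : o = o' := by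
  generalize hl : ((none, o) : Loc) = m at h
  cases h <;> simp_all

theorem Cut.Trace.not_onSpine {K : Cut P Q} {o o' : Pos} (h : K.Trace (some 0, o) o') :
    ¬ K.OnSpine o := by
  generalize hl : ((some 0, o) : Loc) = m at h
  cases h <;> simp_all

/-- Every term occurring in the conclusion of a cut is parametric. -/
theorem Cut.trace_of_tm {K : Cut P Q} {o : Pos} {ρ : Part} {t : Ty} {a : Tm P Q t}
    (h : K.concl.sub o = some (ρ, ⟨t, .tm a⟩)) : K.Trace (none, o) o := by
  obtain ⟨π, q⟩ := o
  -- An address is at or below the cut address, and then belongs to the copy of `z`; or strictly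
  -- above it, where no term stands; or off the path, where the left premise is unchanged.
  by_cases h1 : π = K.pos.1 ∧ K.pos.2 <+: q
  · obtain ⟨rfl, r, rfl⟩ := h1
    rw [Cut.sub_concl_right] at h
    exact .conclRight (Str.occ_iff.2 h)
  · by_cases h2 : K.OnSpine (π, q)
    · obtain ⟨h3, h4⟩ := h2
      simp only at h3 h4
      subst h3
      by_cases h5 : q = K.pos.2
      · subst h5; simp at h1
      · exact absurd h (Seq.sub_replace_above K.sub_pos h4 h5 a)
    · have e : K.concl.sub (π, q) = K.left.sub (π, q) := Seq.sub_replace_off K.sub_pos h2 h1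
      rw [e] at h
      exact .conclLeft (Seq.occ_iff.2 h) h2

/-- Congruent parameters have the same trace, and by `Cut.Trace.occ_iff` what occurs at a parameter
is what the conclusion has at its trace. This gives `Cut.c2` and `Cut.c4`; `Cut.c3` holds because a
parameter of the conclusion is its own trace. -/
theorem Cut.c2 (K : Cut P Q) (l l' : Loc) (h : K.toInference.cong l l') :
    ∃ (t : Ty) (y : Structure P Q t),
      (∃ ρ, K.toInference.Occ l ρ y) ∧ ∃ ρ, K.toInference.Occ l' ρ y := by
  obtain ⟨o, h1, h2⟩ := h
  obtain ⟨ρ, w, y, h3⟩ := h1.exists_occ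
  exact ⟨w, y, ⟨ρ, (h1.occ_iff y).2 h3⟩, ρ, (h2.occ_iff y).2 h3⟩

theorem Cut.c3 (K : Cut P Q) (l : Loc) (o o' : Pos) (h : K.toInference.cong l (none, o))
    (h' : K.toInference.cong l (none, o')) : o = o' := by
  obtain ⟨q, h1, h2⟩ := h
  obtain ⟨q', h1', h2'⟩ := h'
  rw [Cut.trace_none h2, Cut.trace_none h2', h1.unique h1']

theorem Cut.c4 (K : Cut P Q) (l l' : Loc) (h : K.toInference.cong l l') (t : Ty)
    (y : Structure P Q t) (ρ : Part) (t' : Ty) (y' : Structure P Q t') (ρ' : Part)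
    (hy : K.toInference.Occ l ρ y) (hy' : K.toInference.Occ l' ρ' y') : ρ = ρ' := by
  obtain ⟨o, h1, h2⟩ := h
  have e1 := (h1.occ_iff y).1 hy
  have e2 := (h2.occ_iff y').1 hy'
  rw [e1] at e2
  exact (Prod.mk.inj (Option.some.inj e2)).1

theorem Cut.not_principal (K : Cut P Q) (o : Pos) (ρ : Part) {t : Ty} (a : Tm P Q t) :
    ¬ K.toInference.Principal o ρ a := fun h =>
  have := Cut.trace_of_tm (Seq.occ_iff.1 h.1)
  h.2 ⟨o, this, this⟩

/-- Substituting for a parametric term in a cut gives a cut on the same term, at the same address,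
in a sequent of the same type. -/
theorem Cut.subst_parametric (K : Cut P Q) (l : Loc) (t : Ty) (b : Tm P Q t) (ρ : Part)
    (hl : K.toInference.Parametric l) (hb : K.toInference.Occ l ρ (.tm b : Structure P Q t))
    (z : Structure P Q t) :
    ∃ K' : Cut P Q, (K'.ty = K.ty ∧ K'.left.lty = K.left.lty ∧ K'.left.rty = K.left.rty ∧
      K'.pos = K.pos) ∧ K'.toInference.prems = K.toInference.replacePrems l z ∧
        K'.toInference.concl = K.toInference.replaceConcl l z := by
  obtain ⟨o, ho, -⟩ := hl
  have hbo := (ho.occ_iff _).1 hb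
  have hcong : ∀ l', K.toInference.cong l l' ↔ K.Trace l' o := fun l' =>
    ⟨fun ⟨o', h1, h2⟩ => by rwa [ho.unique h1], fun h => ⟨o, ho, h⟩⟩
  have hright : ∀ o' u, K.right.sub o' = some u → ∀ q, K.Trace (some 1, o') q →
      ∃ p, o' = (suc, p) ∧ q = (K.pos.1, K.pos.2 ++ p) := by
    intro o' u hu q hq
    generalize hm : ((some 1, o') : Loc) = m at hq
    cases hq <;> simp_all
  have hleft : ∀ o', K.Trace (some 0, o') o → o' = o := by
    intro o' hq
    generalize hm : ((some 0, o') : Loc) = m at hq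
    cases hq <;> simp_all
  have hc : K.toInference.replaceConcl l z = K.concl.replace z fun o' => o' = o := by
    refine Seq.replace_congr _ _ fun o' u hu => ?_
    rw [hcong]
    exact ⟨fun h => Cut.trace_none h, fun h => by subst h; exact Cut.trace_of_tm hbo⟩
  have hp : K.toInference.replacePrems l z = [K.left.replace z fun o' => K.Trace (some 0, o') o,
      K.right.replace z fun o' => K.Trace (some 1, o') o] := by
    simp [Inference.replacePrems, Cut.toInference, ← hcong]
  rw [hc, hp]
  -- If the term lies in the copy of `z`, the new cut has a modified `z`. Otherwise it lies in the
  -- left premise off the path to the cut term, and the new cut has a modified left premise.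
  by_cases h1 : o.1 = K.pos.1 ∧ K.pos.2 <+: o.2
  · obtain ⟨π, q⟩ := o
    obtain ⟨h1, p, h2⟩ := h1
    simp only at h1 h2
    subst h1 h2
    rw [Cut.sub_concl_right] at hbo
    refine ⟨{ K with z := Str.replace z K.z fun r => r = p }, ⟨rfl, rfl, rfl, rfl⟩, ?_, ?_⟩
    · simp only [Cut.toInference]
      congr 1
      -- A location of the left premise whose trace is at or below the cut address would be the cut
      -- term itself, which is no parameter. So the left premise does not change.
      · refine (Seq.replace_not _ _ fun o' u hu h => ?_).symm
        have h' := hleft _ h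
        subst h'
        have := Seq.sub_leaf K.sub_pos (Str.leaf_tm _) hu
        subst this
        exact Cut.Trace.not_onSpine h ⟨rfl, by simp⟩
      · congr 1
        have : (K.right.replace z fun o' => K.Trace (some 1, o') (K.pos.1, K.pos.2 ++ p)) =
            K.right.replace z fun o' => o' = (suc, p) := by
          refine Seq.replace_congr _ _ fun o' u hu => ⟨fun h => ?_, ?_⟩
          · obtain ⟨p', rfl, h'⟩ := hright _ _ hu _ h
            simp at h'
            rw [h']
          · rintro rfl
            exact .right (Str.occ_iff.2 hbo)
        rw [this, Seq.replace_suc]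
        rfl
    · exact (Seq.replace_below K.sub_pos z p).symm
  · by_cases h2 : K.OnSpine o
    · obtain ⟨π, q⟩ := o
      obtain ⟨h3, h4⟩ := h2
      simp only at h3 h4
      subst h3
      by_cases h5 : q = K.pos.2
      · subst h5; simp at h1
      · exact absurd hbo (Seq.sub_replace_above K.sub_pos h4 h5 b)
    · have hob : K.left.sub o = some (ρ, ⟨t, .tm b⟩) :=
        (Seq.sub_replace_off K.sub_pos h2 h1).symm.trans hbo
      have hne : K.pos ≠ o := by rintro rfl; exact h2 ⟨rfl, by simp⟩
      -- The addresses of the replaced term and of the cut term are incomparable, so the cut term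
      -- survives the replacement.
      have hocc : (K.left.replace z fun o' => o' = o).sub K.pos =
          some (suc, ⟨K.ty, .tm K.term⟩) := by
        rw [← K.sub_pos]
        refine Seq.sub_replace_off hob ?_ ?_
        · rintro ⟨h3, h4⟩; exact h1 ⟨h3.symm, h4⟩
        · rintro ⟨h3, h4⟩; exact h2 ⟨h3.symm, h4⟩
      refine ⟨{ K with
        left := K.left.replace z fun o' => o' = o
        occ := Seq.occ_iff.2 hocc }, ⟨rfl, rfl, rfl, rfl⟩, ?_, ?_⟩
      · simp only [Cut.toInference]
        congr 1
        · refine Seq.replace_congr _ _ fun o' u hu => ⟨?_, fun h => hleft _ h⟩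
          rintro rfl
          exact .left (Seq.occ_iff.2 hob) h2
        · congr 1
          refine (Seq.replace_not _ _ fun o' u hu h => ?_).symm
          obtain ⟨p', rfl, h'⟩ := hright _ _ hu _ h
          exact h1 (by rw [h']; simp)
      · exact (Seq.replace_comm K.sub_pos hob hne.symm z).symm

end

section
variable {P : Type u} {Q : Type v} {V W : Type}

/-! ### Variables and terms of a pattern -/

/-- The variables of a structure, each with the part it is and its address. -/
def Str.vars : {t : Ty} → Part → Str P Q V t → List ((Ty × V) × Part × Path)
  | t, π, .var n => [((t, n), π, [])]
  | _, _, .tm _ => []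
  | _, _, .nul _ => []
  | _, π, .un _ x => (x.vars π).map fun v => (v.1, v.2.1, .fst :: v.2.2)
  | _, π, .bin c x y => ((x.vars (c.fstPart π)).map fun v => (v.1, v.2.1, .fst :: v.2.2)) ++
      (y.vars (c.sndPart π)).map fun v => (v.1, v.2.1, .snd :: v.2.2)

/-- The operational terms of a structure. -/
def Str.tms : {t : Ty} → Str P Q V t → List (AnyTm P Q)
  | _, .var _ => []
  | t, .tm a => [⟨t, a⟩]
  | _, .nul _ => []
  | _, .un _ x => x.tms
  | _, .bin _ x y => x.tms ++ y.tms

/-- The variables of a sequent, each with the part it is and its address. -/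
def Seq.vars (S : Seq P Q V) : List ((Ty × V) × Part × Pos) :=
  (S.ante.vars pre).map (fun v => (v.1, v.2.1, (pre, v.2.2))) ++
    (S.cons.vars suc).map fun v => (v.1, v.2.1, (suc, v.2.2))

/-- The operational terms of a sequent. -/
def Seq.tms (S : Seq P Q V) : List (AnyTm P Q) := S.ante.tms ++ S.cons.tms

/-- Links the lists, on which linearity and position can be checked by evaluation, with occurrences.
-/
theorem Str.mem_vars {t k : Ty} {n : V} {π ρ : Part} {p : Path} {x : Str P Q V t} :
    ((k, n), ρ, p) ∈ x.vars π ↔ x.sub π p = some (ρ, ⟨k, .var n⟩) := by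
  induction x generalizing π p with
  | var m =>
    rcases p with _ | ⟨_, p⟩
    · simp only [Str.vars, List.mem_singleton, Prod.mk.injEq, Str.sub_nil, Option.some.injEq,
        Sigma.mk.injEq]
      constructor
      · rintro ⟨⟨rfl, rfl⟩, rfl, -⟩; simp
      · rintro ⟨rfl, rfl, h⟩; cases h; simp
    · simp [Str.vars]
  | tm m =>
    rcases p with _ | ⟨_, p⟩
    · simp only [Str.vars, Str.sub_nil]
      simp only [List.not_mem_nil, Option.some.injEq, Prod.mk.injEq, Sigma.mk.injEq, false_iff]
      rintro ⟨-, rfl, h⟩; cases h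
    · simp [Str.vars]
  | nul m =>
    rcases p with _ | ⟨_, p⟩
    · simp only [Str.vars, Str.sub_nil]
      simp only [List.not_mem_nil, Option.some.injEq, Prod.mk.injEq, Sigma.mk.injEq, false_iff]
      rintro ⟨-, rfl, h⟩; cases h
    · simp [Str.vars]
  | un c x ih =>
    rcases p with _ | ⟨_ | _, p⟩
    · simp only [Str.vars, Str.sub_nil]
      simp only [List.mem_map, Prod.mk.injEq, Option.some.injEq, Sigma.mk.injEq]
      constructor
      · simp
      · rintro ⟨-, rfl, h⟩; cases h
    · simp [Str.vars, ← ih]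
    · simp [Str.vars]
  | bin c x y ihx ihy =>
    rcases p with _ | ⟨_ | _, p⟩
    · simp only [Str.vars, Str.sub_nil]
      simp only [List.mem_append, List.mem_map, Prod.mk.injEq, Option.some.injEq, Sigma.mk.injEq]
      constructor
      · simp
      · rintro ⟨-, rfl, h⟩; cases h
    · simp [Str.vars, ← ihx]
    · simp [Str.vars, ← ihy]

theorem Seq.mem_vars {k : Ty} {n : V} {ρ : Part} {o : Pos} {S : Seq P Q V} :
    ((k, n), ρ, o) ∈ S.vars ↔ S.sub o = some (ρ, ⟨k, .var n⟩) := by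
  obtain ⟨_ | _, p⟩ := o <;> simp [Seq.vars, ← Str.mem_vars]

theorem Str.mem_tms {t : Ty} (π : Part) {x : Str P Q V t} {a : AnyTm P Q} :
    a ∈ x.tms ↔ ∃ p ρ, x.sub π p = some (ρ, ⟨a.1, .tm a.2⟩) := by
  constructor
  · intro h
    induction x generalizing π with
    | tm b => simp only [Str.tms, List.mem_singleton] at h; subst h; exact ⟨[], π, by simp⟩
    | un c x ih =>
      obtain ⟨p, ρ, h⟩ := ih π h
      exact ⟨.fst :: p, ρ, h⟩
    | bin c x y ihx ihy =>
      rcases List.mem_append.1 h with h | h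
      · obtain ⟨p, ρ, h⟩ := ihx (c.fstPart π) h
        exact ⟨.fst :: p, ρ, h⟩
      · obtain ⟨p, ρ, h⟩ := ihy (c.sndPart π) h
        exact ⟨.snd :: p, ρ, h⟩
    | _ => simp [Str.tms] at h
  · rintro ⟨p, ρ, h⟩
    induction x generalizing π p with
    | un c x ih =>
      rcases p with _ | ⟨_ | _, p⟩
      · simp only [Str.sub_nil, Option.some.injEq, Prod.mk.injEq, Sigma.mk.injEq] at h
        obtain ⟨-, rfl, h⟩ := h; cases h
      · exact ih _ _ h
      · simp at h
    | bin c x y ihx ihy =>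
      rcases p with _ | ⟨_ | _, p⟩
      · simp only [Str.sub_nil, Option.some.injEq, Prod.mk.injEq, Sigma.mk.injEq] at h
        obtain ⟨-, rfl, h⟩ := h; cases h
      · exact List.mem_append_left _ (ihx _ _ h)
      · exact List.mem_append_right _ (ihy _ _ h)
    | _ =>
      rcases p with _ | ⟨_, p⟩
      · simp only [Str.sub_nil, Option.some.injEq, Prod.mk.injEq, Sigma.mk.injEq] at h
        obtain ⟨-, rfl, h⟩ := h
        cases h <;> simp [Str.tms]
      · simp at h

theorem Seq.mem_tms {S : Seq P Q V} {a : AnyTm P Q} :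
    a ∈ S.tms ↔ ∃ o ρ, S.sub o = some (ρ, ⟨a.1, .tm a.2⟩) := by
  rw [Seq.tms, List.mem_append, Str.mem_tms pre, Str.mem_tms suc]
  constructor
  · rintro (⟨p, h⟩ | ⟨p, h⟩)
    · exact ⟨(pre, p), h⟩
    · exact ⟨(suc, p), h⟩
  · rintro ⟨⟨_ | _, p⟩, h⟩
    · exact .inl ⟨p, h⟩
    · exact .inr ⟨p, h⟩

theorem Seq.hasTerm_iff {S : Seq P Q V} {a : AnyTm P Q} : S.HasTerm a ↔ a ∈ S.tms := by
  simp only [Seq.HasTerm, Seq.occ_iff, Seq.mem_tms]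

/-! ### Substitution -/

variable {σ : (t : Ty) → V → Str P Q W t}

theorem Str.sub_subst {t w : Ty} {π ρ : Part} {x : Str P Q V t} {q : Path} {y : Str P Q V w}
    (h : x.sub π q = some (ρ, ⟨w, y⟩)) (r : Path) :
    (x.subst σ).sub π (q ++ r) = (y.subst σ).sub ρ r := by
  induction x generalizing π q with
  | un c x ih =>
    rcases q with _ | ⟨_ | _, q⟩
    · simp only [Str.sub_nil, Option.some.injEq, Prod.mk.injEq, Sigma.mk.injEq] at h
      obtain ⟨rfl, rfl, h⟩ := h; cases h; rfl
    · exact ih h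
    · simp at h
  | bin c x y ihx ihy =>
    rcases q with _ | ⟨_ | _, q⟩
    · simp only [Str.sub_nil, Option.some.injEq, Prod.mk.injEq, Sigma.mk.injEq] at h
      obtain ⟨rfl, rfl, h⟩ := h; cases h; rfl
    · exact ihx h
    · exact ihy h
  | _ =>
    rcases q with _ | ⟨_, q⟩
    · simp only [Str.sub_nil, Option.some.injEq, Prod.mk.injEq, Sigma.mk.injEq] at h
      obtain ⟨rfl, rfl, h⟩ := h; cases h; rfl
    · simp at h

theorem Seq.sub_subst {w : Ty} {π ρ : Part} {S : Seq P Q V} {q : Path} {y : Str P Q V w}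
    (h : S.sub (π, q) = some (ρ, ⟨w, y⟩)) (r : Path) :
    (S.subst σ).sub (π, q ++ r) = (y.subst σ).sub ρ r := by
  cases π
  · exact Str.sub_subst h r
  · exact Str.sub_subst h r

/-- A term of an instance of a pattern is a term of the pattern, or lies in a variable. -/
theorem Str.sub_subst_tm {t w : Ty} {π ρ : Part} {x : Str P Q V t} {p : Path} {a : Tm P Q w}
    (h : (x.subst σ).sub π p = some (ρ, ⟨w, .tm a⟩)) :
    x.sub π p = some (ρ, ⟨w, .tm a⟩) ∨ ∃ q r k n κ, p = q ++ r ∧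
      x.sub π q = some (κ, ⟨k, .var n⟩) ∧ (σ k n).sub κ r = some (ρ, ⟨w, .tm a⟩) := by
  induction x generalizing π p with
  | var n => exact .inr ⟨[], p, _, n, π, rfl, by simp, h⟩
  | un c x ih =>
    rcases p with _ | ⟨_ | _, p⟩
    · simp only [Str.sub_nil, Option.some.injEq, Prod.mk.injEq, Sigma.mk.injEq] at h
      obtain ⟨rfl, rfl, h⟩ := h; cases h
    · rcases ih h with h' | ⟨q, r, k, n, κ, rfl, h'⟩
      · exact .inl h'
      · exact .inr ⟨.fst :: q, r, k, n, κ, rfl, h'⟩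
    · cases h
  | bin c x y ihx ihy =>
    rcases p with _ | ⟨_ | _, p⟩
    · simp only [Str.sub_nil, Option.some.injEq, Prod.mk.injEq, Sigma.mk.injEq] at h
      obtain ⟨rfl, rfl, h⟩ := h; cases h
    · rcases ihx h with h' | ⟨q, r, k, n, κ, rfl, h'⟩
      · exact .inl h'
      · exact .inr ⟨.fst :: q, r, k, n, κ, rfl, h'⟩
    · rcases ihy h with h' | ⟨q, r, k, n, κ, rfl, h'⟩
      · exact .inl h'
      · exact .inr ⟨.snd :: q, r, k, n, κ, rfl, h'⟩
  | tm b =>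
    rcases p with _ | ⟨_, p⟩
    · simp only [Str.subst, Str.sub_nil, Option.some.injEq, Prod.mk.injEq, Sigma.mk.injEq] at h
      obtain ⟨rfl, rfl, h⟩ := h; cases h; simp
    · simp [Str.subst] at h
  | nul b =>
    rcases p with _ | ⟨_, p⟩
    · simp only [Str.subst, Str.sub_nil, Option.some.injEq, Prod.mk.injEq, Sigma.mk.injEq] at h
      obtain ⟨rfl, rfl, h⟩ := h; cases h
    · simp [Str.subst] at h

theorem Seq.sub_subst_tm {w : Ty} {π ρ : Part} {S : Seq P Q V} {p : Path} {a : Tm P Q w}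
    (h : (S.subst σ).sub (π, p) = some (ρ, ⟨w, .tm a⟩)) :
    S.sub (π, p) = some (ρ, ⟨w, .tm a⟩) ∨ ∃ q r k n κ, p = q ++ r ∧
      S.sub (π, q) = some (κ, ⟨k, .var n⟩) ∧ (σ k n).sub κ r = some (ρ, ⟨w, .tm a⟩) := by
  cases π
  · exact Str.sub_subst_tm h
  · exact Str.sub_subst_tm h

/-- If replacement touches only the structures substituted for variables (`h2`), and has the same
effect at all occurrences of a variable (`h1`), it amounts to a change of the assignment. -/
theorem Str.replace_subst {t w : Ty} {π : Part} {x : Str P Q V t} {z : Str P Q W w}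
    {f : Path → Prop} {σ' : (t : Ty) → V → Str P Q W t}
    (h1 : ∀ q ρ k n, x.sub π q = some (ρ, ⟨k, .var n⟩) →
      Str.replace z (σ k n) (fun r => f (q ++ r)) = σ' k n)
    (h2 : ∀ q u, x.sub π q = some u → (∀ n, u.2.2 ≠ .var n) → ¬ f q) :
    Str.replace z (x.subst σ) f = x.subst σ' := by
  induction x generalizing π f with
  | var n => exact h1 [] π _ n (by simp)
  | un c x ih =>
    have h0 : ¬ f [] := h2 [] _ (Str.sub_nil _ _) (by simp)
    simp only [Str.subst]
    rw [Str.replace_un _ _ _ h0, ih (π := π)]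
    · exact fun q => h1 (.fst :: q)
    · exact fun q => h2 (.fst :: q)
  | bin c x y ihx ihy =>
    have h0 : ¬ f [] := h2 [] _ (Str.sub_nil _ _) (by simp)
    simp only [Str.subst]
    rw [Str.replace_bin _ _ _ _ h0, ihx (π := c.fstPart π), ihy (π := c.sndPart π)]
    · exact fun q => h1 (.snd :: q)
    · exact fun q => h2 (.snd :: q)
    · exact fun q => h1 (.fst :: q)
    · exact fun q => h2 (.fst :: q)
  | _ =>
    have h0 : ¬ f [] := h2 [] _ (Str.sub_nil _ _) (by simp)
    simp [Str.subst, Str.replace, graft, h0]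

theorem Seq.replace_subst {w : Ty} {S : Seq P Q V} {z : Str P Q W w}
    {f : Pos → Prop} {σ' : (t : Ty) → V → Str P Q W t}
    (h1 : ∀ π q ρ k n, S.sub (π, q) = some (ρ, ⟨k, .var n⟩) →
      Str.replace z (σ k n) (fun r => f (π, q ++ r)) = σ' k n)
    (h2 : ∀ o u, S.sub o = some u → (∀ n, u.2.2 ≠ .var n) → ¬ f o) :
    (S.subst σ).replace z f = S.subst σ' := by
  unfold Seq.replace Seq.subst
  congr 1
  · exact Str.replace_subst (π := pre) (h1 pre) fun q => h2 (pre, q)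
  · exact Str.replace_subst (π := suc) (h1 suc) fun q => h2 (suc, q)

end

/-! ### Well-formed schemas -/

section
variable {P : Type u} {Q : Type v}

/-- Syntactic conditions on a schema that yield the conditions on its instances. -/
structure Schema.Good (s : Schema P Q) : Prop where
  uniform : s.concl.lty = s.concl.rty
  linear : (s.concl.vars.map Prod.fst).Nodup
  params : ∀ S ∈ s.prems, ∀ v ∈ S.vars,
    (v.1, v.2.1) ∈ s.concl.vars.map fun v => (v.1, v.2.1)
  ante_tms : s.concl.ante.tms = [] ∨ ∃ a, s.concl.ante = .tm a
  cons_tms : s.concl.cons.tms = [] ∨ ∃ a, s.concl.cons = .tm a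
  tms : ∀ S ∈ s.prems, ∀ a ∈ S.tms, ∃ b ∈ s.concl.tms, ImmSub a b

variable {s : Schema P Q} {σ : (t : Ty) → ℕ → Structure P Q t}

theorem Schema.occ_inst {l : Loc} {ρ : Part} {w : Ty} {y : Structure P Q w} :
    (s.inst σ).Occ l ρ y ↔
      ∃ S, s.seq? l.1 = some S ∧ (S.subst σ).sub l.2 = some (ρ, ⟨w, y⟩) := by
  obtain ⟨_ | i, o⟩ := l
  · simp [Inference.Occ, Schema.inst, Schema.seq?, Seq.occ_iff]
  · simp [Inference.Occ, Schema.inst, Schema.seq?, Seq.occ_iff]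

/-- `Schema.InVar` asks that `r` be an address of `σ t n` for some part of its root. Here the root
gets the part which the variable has at the given occurrence. -/
theorem Schema.inVar_iff {l : Loc} {t : Ty} {n : ℕ} {r : Path} :
    s.InVar σ l t n r ↔ ∃ S q ρ ρ' y, s.seq? l.1 = some S ∧ l.2.2 = q ++ r ∧
      S.sub (l.2.1, q) = some (ρ, ⟨t, .var n⟩) ∧ (σ t n).sub ρ r = some (ρ', y) := by
  constructor
  · rintro ⟨⟨S, q, ρ, h1, h2, h3⟩, w, y, π, κ, h4⟩
    obtain ⟨ρ', h5⟩ := Str.sub_part ρ (Str.occ_iff.1 h4)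
    exact ⟨S, q, ρ, ρ', _, h1, h3, Seq.occ_iff.1 h2, h5⟩
  · rintro ⟨S, q, ρ, ρ', y, h1, h3, h2, h4⟩
    exact ⟨⟨S, q, ρ, h1, Seq.occ_iff.2 h2, h3⟩, _, _, _, _, Str.occ_iff.2 h4⟩

/-- Two variable occurrences above one location have comparable addresses. As variables are leaves
of the pattern, the addresses agree, and so do the variables. -/
theorem Schema.InVar.unique {l : Loc} {t t' : Ty} {n n' : ℕ} {r r' : Path}
    (h : s.InVar σ l t n r) (h' : s.InVar σ l t' n' r') : t = t' ∧ n = n' ∧ r = r' := by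
  obtain ⟨S, q, ρ, κ, y, h1, h2, h3, h4⟩ := Schema.inVar_iff.1 h
  obtain ⟨S', q', ρ', κ', y', h1', h2', h3', h4'⟩ := Schema.inVar_iff.1 h'
  rw [h1] at h1'
  cases h1'
  rw [h2] at h2'
  have hq : q = q' := by
    rcases List.append_eq_append_iff.1 h2' with ⟨c, rfl, rfl⟩ | ⟨c, rfl, rfl⟩
    · have := Seq.sub_leaf h3 (Str.leaf_var n) h3'
      simp [this]
    · have := Seq.sub_leaf h3' (Str.leaf_var n') h3
      simp [this]
  subst hq
  rw [h3] at h3'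
  simp only [Option.some.injEq, Prod.mk.injEq, Sigma.mk.injEq] at h3'
  obtain ⟨rfl, rfl, h3'⟩ := h3'
  cases h3'
  exact ⟨rfl, rfl, List.append_cancel_left h2'⟩

/-- A congruence class is thus determined by a variable and an inner address. -/
theorem Schema.cong_iff {l l' : Loc} {t : Ty} {n : ℕ} {r : Path} (h : s.InVar σ l t n r) :
    (s.inst σ).cong l l' ↔ s.InVar σ l' t n r := by
  constructor
  · rintro ⟨t', n', r', h1, h2⟩
    obtain ⟨rfl, rfl, rfl⟩ := h.unique h1
    exact h2
  · exact fun h' => ⟨t, n, r, h, h'⟩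

theorem Schema.inst_c2 (l l' : Loc) (h : (s.inst σ).cong l l') :
    ∃ (t : Ty) (y : Structure P Q t),
      (∃ ρ, (s.inst σ).Occ l ρ y) ∧ ∃ ρ, (s.inst σ).Occ l' ρ y := by
  obtain ⟨t, n, r, h1, h2⟩ := h
  obtain ⟨i, π, p⟩ := l
  obtain ⟨i', π', p'⟩ := l'
  obtain ⟨S, q, ρ, κ, ⟨w, y⟩, h1, h3, h4, h5⟩ := Schema.inVar_iff.1 h1
  obtain ⟨S', q', ρ', κ', y', h1', h3', h4', h5'⟩ := Schema.inVar_iff.1 h2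
  obtain ⟨κ'', h6⟩ := Str.sub_part ρ' h5
  simp only at h3 h3'
  subst h3 h3'
  exact ⟨w, y, ⟨κ, Schema.occ_inst.2 ⟨S, h1, (Seq.sub_subst h4 r).trans h5⟩⟩, κ'',
    Schema.occ_inst.2 ⟨S', h1', (Seq.sub_subst h4' r).trans h6⟩⟩

/-- Linearity of the conclusion. It gives non-proliferation of parameters, and it fixes the part of
each variable in the whole rule. -/
theorem Schema.Good.var_unique (hs : s.Good) {k : Ty} {n : ℕ} {ρ ρ' : Part} {o o' : Pos}
    (h : s.concl.sub o = some (ρ, ⟨k, .var n⟩)) (h' : s.concl.sub o' = some (ρ', ⟨k, .var n⟩)) :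
    ρ = ρ' ∧ o = o' := by
  have := List.inj_on_of_nodup_map hs.linear (Seq.mem_vars.2 h) (Seq.mem_vars.2 h') rfl
  simpa using this

theorem Schema.Good.exists_concl (hs : s.Good) {i : Option ℕ} {S : Seq P Q ℕ}
    (hS : s.seq? i = some S) {k : Ty} {n : ℕ} {ρ : Part} {o : Pos}
    (h : S.sub o = some (ρ, ⟨k, .var n⟩)) : ∃ o', s.concl.sub o' = some (ρ, ⟨k, .var n⟩) := by
  rcases i with _ | i
  · cases hS
    exact ⟨o, h⟩
  · have := hs.params S (List.mem_of_getElem? hS) _ (Seq.mem_vars.2 h)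
    simp only [List.mem_map, Prod.mk.injEq] at this
    obtain ⟨⟨⟨k', n'⟩, ρ', o'⟩, h1, h2, h3⟩ := this
    cases h2
    cases h3
    exact ⟨o', Seq.mem_vars.1 h1⟩

theorem Schema.Good.inst_c3 (hs : s.Good) (l : Loc) (o o' : Pos)
    (h : (s.inst σ).cong l (none, o)) (h' : (s.inst σ).cong l (none, o')) : o = o' := by
  obtain ⟨t, n, r, h1, h2⟩ := h
  rw [Schema.cong_iff h1] at h'
  obtain ⟨π, p⟩ := o
  obtain ⟨π', p'⟩ := o'
  obtain ⟨S, q, ρ, κ, _, h1, h3, h4, -⟩ := Schema.inVar_iff.1 h2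
  obtain ⟨S', q', ρ', κ', y', h1', h3', h4', -⟩ := Schema.inVar_iff.1 h'
  cases h1
  cases h1'
  simp only at h3 h3'
  subst h3 h3'
  have := (hs.var_unique h4 h4').2
  simp_all

/-- Both occurrences of the variable have the part of its only occurrence in the conclusion, and the
inner address transforms this part in the same way. -/
theorem Schema.Good.inst_c4 (hs : s.Good) (l l' : Loc) (h : (s.inst σ).cong l l') (t : Ty)
    (y : Structure P Q t) (ρ : Part) (t' : Ty) (y' : Structure P Q t') (ρ' : Part)
    (hy : (s.inst σ).Occ l ρ y) (hy' : (s.inst σ).Occ l' ρ' y') : ρ = ρ' := by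
  obtain ⟨k, n, r, h1, h2⟩ := h
  obtain ⟨i, π, p⟩ := l
  obtain ⟨i', π', p'⟩ := l'
  obtain ⟨S, q, κ, _, _, h1, h3, h4, -⟩ := Schema.inVar_iff.1 h1
  obtain ⟨S', q', κ', _, _, h1', h3', h4', -⟩ := Schema.inVar_iff.1 h2
  obtain ⟨T, hT, hy⟩ := Schema.occ_inst.1 hy
  obtain ⟨T', hT', hy'⟩ := Schema.occ_inst.1 hy'
  rw [h1] at hT
  rw [h1'] at hT'
  cases hT
  cases hT'
  simp only at h3 h3'
  subst h3 h3'
  obtain ⟨o, ho⟩ := hs.exists_concl h1 h4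
  obtain ⟨o', ho'⟩ := hs.exists_concl h1' h4'
  obtain ⟨rfl, -⟩ := hs.var_unique ho ho'
  rw [Seq.sub_subst h4] at hy
  rw [Seq.sub_subst h4', hy] at hy'
  exact (Prod.mk.inj (Option.some.inj hy')).1

/-- Principal terms are exactly those written in the schema, whatever the assignment. They therefore
stay principal when the assignment changes. -/
theorem Schema.principal_iff {o : Pos} {ρ : Part} {t : Ty} {a : Tm P Q t} :
    (s.inst σ).Principal o ρ a ↔ s.concl.sub o = some (ρ, ⟨t, .tm a⟩) := by
  obtain ⟨π, p⟩ := o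
  constructor
  · rintro ⟨h1, h2⟩
    rcases Seq.sub_subst_tm (Seq.occ_iff.1 h1) with h | ⟨q, r, k, n, κ, rfl, h3, h4⟩
    · exact h
    · have : s.InVar σ (none, (π, q ++ r)) k n r :=
        Schema.inVar_iff.2 ⟨s.concl, q, κ, ρ, _, rfl, rfl, h3, h4⟩
      exact absurd ⟨k, n, r, this, this⟩ h2
  · intro h
    refine ⟨Seq.occ_iff.2 ?_, ?_⟩
    · have := Seq.sub_subst (σ := σ) h []
      simpa [Str.subst, Schema.inst] using this
    · rintro ⟨k, n, r, h1, -⟩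
      obtain ⟨S, q, κ, κ', y, h1, h2, h3, h4⟩ := Schema.inVar_iff.1 h1
      cases h1
      simp only at h2
      subst h2
      obtain rfl := Seq.sub_leaf h3 (Str.leaf_var n) h
      rw [List.append_nil] at h
      rw [h3] at h
      simp only [Option.some.injEq, Prod.mk.injEq, Sigma.mk.injEq] at h
      obtain ⟨-, rfl, h⟩ := h
      cases h

/-- The terms of the conclusion of a schema are in display. -/
theorem Schema.Good.display (hs : s.Good) {o : Pos} {ρ : Part} {t : Ty} {a : Tm P Q t}
    (h : s.concl.sub o = some (ρ, ⟨t, .tm a⟩)) : o = (ρ, []) := by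
  have key : ∀ {k : Ty} {π : Part} {x : Str P Q ℕ k} {p : Path},
      (x.tms = [] ∨ ∃ a, x = .tm a) → x.sub π p = some (ρ, ⟨t, .tm a⟩) → ρ = π ∧ p = [] := by
    rintro k π x p (h | ⟨b, rfl⟩) h'
    · have : (⟨t, a⟩ : AnyTm P Q) ∈ x.tms := (Str.mem_tms π).2 ⟨p, ρ, h'⟩
      simp [h] at this
    · rcases p with _ | ⟨_, p⟩
      · simp at h'
        simp [h'.1]
      · simp at h'
  obtain ⟨_ | _, p⟩ := o
  · obtain ⟨rfl, rfl⟩ := key hs.ante_tms h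
    rfl
  · obtain ⟨rfl, rfl⟩ := key hs.cons_tms h
    rfl

/-- A term of a premise is either written in the schema, and then is an immediate subterm of a term
in the conclusion, or comes from a variable, which recurs in the conclusion. -/
theorem Schema.Good.inst_c1 (hs : s.Good) (S : Sequent P Q) (hS : S ∈ (s.inst σ).prems)
    (a : AnyTm P Q) (ha : S.HasTerm a) : ∃ b, (s.inst σ).concl.HasTerm b ∧ Subterm a b := by
  simp only [Schema.inst, List.mem_map] at hS
  obtain ⟨S, hS, rfl⟩ := hS
  obtain ⟨⟨π, p⟩, ρ, h⟩ := Seq.mem_tms.1 (Seq.hasTerm_iff.1 ha)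
  rcases Seq.sub_subst_tm h with h | ⟨q, r, k, n, κ, rfl, h1, h2⟩
  · obtain ⟨b, hb, hab⟩ := hs.tms S hS a (Seq.mem_tms.2 ⟨_, _, h⟩)
    obtain ⟨⟨π', o⟩, ρ', hb⟩ := Seq.mem_tms.1 hb
    have := Seq.sub_subst (σ := σ) hb []
    exact ⟨b, Seq.hasTerm_iff.2 (Seq.mem_tms.2 ⟨_, _, this⟩), .single hab⟩
  · obtain ⟨i, hi⟩ := List.mem_iff_getElem?.1 hS
    obtain ⟨⟨π', q'⟩, h3⟩ := hs.exists_concl (i := some i) hi h1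
    exact ⟨a, Seq.hasTerm_iff.2 (Seq.mem_tms.2 ⟨(π', q' ++ r), ρ, (Seq.sub_subst h3 r).trans h2⟩),
      .refl⟩

/-- Simultaneous substitution for congruent parameters in an instance gives an instance. -/
theorem Schema.inst_subst_parametric (l : Loc) {t : Ty} (hl : (s.inst σ).Parametric l)
    (z : Structure P Q t) : ∃ σ', (s.inst σ').prems = (s.inst σ).replacePrems l z ∧
      (s.inst σ').concl = (s.inst σ).replaceConcl l z := by
  classical
  obtain ⟨k, n, r, hl, -⟩ := hl
  -- Changing the one structure substituted for `n`, at the inner address `r`, changes all members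
  -- of the congruence class at once and nothing else.
  let σ' : (t : Ty) → ℕ → Structure P Q t := fun t' n' =>
    if t' = k ∧ n' = n then Str.replace z (σ t' n') fun r' => r' = r else σ t' n'
  have key : ∀ i S, s.seq? i = some S →
      (S.subst σ).replace z (fun o => (s.inst σ).cong l (i, o)) = S.subst σ' := by
    intro i S hS
    simp only [Schema.cong_iff hl]
    refine Seq.replace_subst (fun π q ρ t' n' hq => ?_) fun o u hu hv h => ?_
    · by_cases h : t' = k ∧ n' = n
      · obtain ⟨rfl, rfl⟩ := h
        simp only [σ', and_self, if_true]
        refine Str.replace_congr _ _ fun r' κ w hr' => ⟨fun h => ?_, ?_⟩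
        · obtain ⟨κ', hκ'⟩ := Str.sub_part ρ hr'
          exact ((Schema.inVar_iff.2 ⟨S, q, ρ, κ', _, hS, rfl, hq, hκ'⟩ :
            s.InVar σ (i, (π, q ++ r')) t' n' r').unique h).2.2
        · rintro rfl
          obtain ⟨κ', hκ'⟩ := Str.sub_part ρ hr'
          exact Schema.inVar_iff.2 ⟨S, q, ρ, κ', _, hS, rfl, hq, hκ'⟩
      · simp only [σ', h, if_false]
        refine Str.replace_not _ _ fun r' κ w hr' h' => h ?_
        obtain ⟨κ', hκ'⟩ := Str.sub_part ρ hr'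
        have := (Schema.inVar_iff.2 ⟨S, q, ρ, κ', _, hS, rfl, hq, hκ'⟩ :
            s.InVar σ (i, (π, q ++ r')) t' n' r').unique h'
        exact ⟨this.1, this.2.1⟩
    -- A parametric address which is also an address of the pattern must carry a variable of the
    -- pattern.
    · obtain ⟨π, p⟩ := o
      obtain ⟨S', q, κ, κ', y, h1, h2, h3, h4⟩ := Schema.inVar_iff.1 h
      rw [hS] at h1
      cases h1
      simp only at h2
      subst h2
      obtain rfl := Seq.sub_leaf h3 (Str.leaf_var n) hu
      rw [List.append_nil, h3] at hu
      cases hu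
      exact hv n rfl
  refine ⟨σ', ?_, (key none s.concl rfl).symm⟩
  simp only [Schema.inst, Inference.replacePrems]
  apply List.ext_getElem
  · simp
  · intro i h1 h2
    simp only [List.getElem_map, List.getElem_mapIdx]
    refine (key (some i) _ ?_).symm
    simp only [List.length_map] at h1
    simp [Schema.seq?, h1]

end

/-! ### The schemas of D.LRC are well formed. -/

section
variable {P : Type u} {Q : Type v}

/-- A decidable form of the conditions of `Schema.Good` on variables. -/
def Schema.checkVars (s : Schema P Q) : Bool :=
  decide (s.concl.lty = s.concl.rty) && decide (s.concl.vars.map Prod.fst).Nodup &&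
  s.prems.all fun S => S.vars.all fun v =>
    decide ((v.1, v.2.1) ∈ s.concl.vars.map fun v => (v.1, v.2.1))

theorem Schema.good_of_checkVars {s : Schema P Q} (h : s.checkVars = true)
    (h1 : s.concl.ante.tms = [] ∨ ∃ a, s.concl.ante = .tm a)
    (h2 : s.concl.cons.tms = [] ∨ ∃ a, s.concl.cons = .tm a)
    (h3 : ∀ S ∈ s.prems, ∀ a ∈ S.tms, ∃ b ∈ s.concl.tms, ImmSub a b) : s.Good := by
  simp only [Schema.checkVars, Bool.and_eq_true, decide_eq_true_eq, List.all_eq_true] at h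
  exact ⟨h.1.1, h.1.2, h.2, h1, h2, h3⟩

/-- A decidable condition on schemas without operational terms. -/
def Schema.check (s : Schema P Q) : Bool :=
  s.checkVars && s.concl.tms.isEmpty && s.prems.all fun S => S.tms.isEmpty

theorem Schema.concl_tms_of_check {s : Schema P Q} (h : s.check = true) : s.concl.tms = [] := by
  simp only [Schema.check, Bool.and_eq_true, List.isEmpty_iff] at h
  exact h.1.2

theorem Schema.good_of_check {s : Schema P Q} (h : s.check = true) : s.Good := by
  have hc := List.append_eq_nil_iff.1 (Schema.concl_tms_of_check h)
  simp only [Schema.check, Bool.and_eq_true, List.all_eq_true, List.isEmpty_iff] at h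
  exact Schema.good_of_checkVars h.1.1 (.inl hc.1) (.inl hc.2)
    fun S hS a ha => by simp [h.2 S hS] at ha

/-- Evaluation suffices even for abstract `P` and `Q`: only names, types and parts of variables are
compared, and lists of terms are merely tested for emptiness. -/
theorem displayPairs_check : ((displayPairs P Q).all fun s =>
    Schema.check ⟨[s.1], s.2⟩ && Schema.check ⟨[s.2], s.1⟩) = true := by
  rfl

theorem structuralPairs_check : ((structuralPairs P Q).all fun s =>
    Schema.check ⟨[s.1], s.2⟩ && Schema.check ⟨[s.2], s.1⟩) = true := by
  rfl

theorem structuralSingles_check : ((structuralSingles P Q).all fun s =>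
    Schema.check ⟨[s.1], s.2⟩) = true := by
  rfl

/-- Rules given by a family of well-formed schemas. -/
def GoodRule (R : Rule P Q) : Prop :=
  ∀ J ∈ R, ∃ (s : Schema P Q) (σ : _), s.Good ∧ J = s.inst σ ∧ ∀ σ', s.inst σ' ∈ R

theorem goodRule_ruleOf {ι : Type*} {s : ι → Schema P Q} (h : ∀ i, (s i).Good) :
    GoodRule (ruleOf s) := by
  rintro J ⟨i, σ, rfl⟩
  exact ⟨s i, σ, h i, rfl, fun σ' => ⟨i, σ', rfl⟩⟩

theorem goodRule_stepRule {s : Seq P Q ℕ × Seq P Q ℕ} (h : Schema.check ⟨[s.1], s.2⟩ = true) :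
    GoodRule (stepRule P Q s) :=
  goodRule_ruleOf fun _ => Schema.good_of_check h

theorem goodRule_display {R : Rule P Q} (h : R ∈ displayRules P Q) : GoodRule R := by
  obtain ⟨s, hs, h⟩ := h
  have := List.all_eq_true.1 displayPairs_check s hs
  rw [Bool.and_eq_true] at this
  rcases h with rfl | rfl
  · exact goodRule_stepRule this.1
  · exact goodRule_stepRule this.2

theorem goodRule_structural {R : Rule P Q} (h : R ∈ structuralRules P Q) : GoodRule R := by
  rcases h with ⟨s, hs, h⟩ | ⟨s, hs, rfl⟩
  · have := List.all_eq_true.1 structuralPairs_check s hs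
    rw [Bool.and_eq_true] at this
    rcases h with rfl | rfl
    · exact goodRule_stepRule this.1
    · exact goodRule_stepRule this.2
  · exact goodRule_stepRule (List.all_eq_true.1 structuralSingles_check s hs)

theorem goodRule_logical {R : Rule P Q} (h : R ∈ logicalRules P Q) : GoodRule R := by
  simp only [logicalRules, Set.mem_insert_iff, Set.mem_singleton_iff] at h
  rcases h with (rfl | rfl | rfl | rfl | rfl | rfl | rfl | rfl | rfl | rfl | rfl | rfl | rfl |
    rfl | rfl | rfl | rfl | rfl | rfl | rfl | rfl | rfl | rfl | rfl | rfl | rfl | rfl | rfl |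
    rfl | rfl) <;>
  · refine goodRule_ruleOf fun i => Schema.good_of_checkVars rfl ?_ ?_ ?_
    · first | exact .inl rfl | exact .inr ⟨_, rfl⟩
    · first | exact .inl rfl | exact .inr ⟨_, rfl⟩
    · simp [Seq.tms, Str.tms, ImmSub, Tm.children]

theorem goodRule {R : Rule P Q} (h : R ∈ (calculus P Q).rules) : GoodRule R := by
  rcases h with (h | h) | h
  · exact goodRule_display h
  · exact goodRule_structural h
  · exact goodRule_logical h

end

section
variable {P : Type u} {Q : Type v}

/-! ### Introduction rules with principal terms in display -/

theorem not_principal_of_stepRule {s : Seq P Q ℕ × Seq P Q ℕ}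
    (h : Schema.check ⟨[s.1], s.2⟩ = true) {J : Inference P Q} (hJ : J ∈ stepRule P Q s)
    (o : Pos) (ρ : Part) {t : Ty} (a : Tm P Q t) : ¬ J.Principal o ρ a := by
  obtain ⟨_, σ, rfl⟩ := hJ
  intro h'
  have := Seq.mem_tms (a := ⟨t, a⟩).2 ⟨o, ρ, Schema.principal_iff.1 h'⟩
  rw [Schema.concl_tms_of_check h] at this
  simp at this

theorem prems_of_stepRule {s : Seq P Q ℕ × Seq P Q ℕ} {J : Inference P Q}
    (hJ : J ∈ stepRule P Q s) : J.prems ≠ [] := by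
  obtain ⟨_, σ, rfl⟩ := hJ
  simp [Schema.inst]

/-- The display postulates and structural rules are one-step schemas without terms. -/
theorem exists_stepRule {R : Rule P Q} (h : R ∈ displayRules P Q ∪ structuralRules P Q) :
    ∃ s, Schema.check ⟨[s.1], s.2⟩ = true ∧ R = stepRule P Q s := by
  rcases h with ⟨s, hs, h⟩ | ⟨s, hs, h⟩ | ⟨s, hs, rfl⟩
  · have := List.all_eq_true.1 displayPairs_check s hs
    rw [Bool.and_eq_true] at this
    rcases h with rfl | rfl
    · exact ⟨s, this.1, rfl⟩
    · exact ⟨s.swap, this.2, rfl⟩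
  · have := List.all_eq_true.1 structuralPairs_check s hs
    rw [Bool.and_eq_true] at this
    rcases h with rfl | rfl
    · exact ⟨s, this.1, rfl⟩
    · exact ⟨s.swap, this.2, rfl⟩
  · exact ⟨s, List.all_eq_true.1 structuralSingles_check s hs, rfl⟩

/-- `RightIntro ps x a`: `x ⊢ a` follows from `ps` by a rule in which `a` is principal. -/
inductive RightIntro : List (Sequent P Q) → {t : Ty} → Structure P Q t → Tm P Q t → Prop
  | prop (p) : RightIntro [] (.tm (.prop p)) (.prop p)
  | atom (a) : RightIntro [] (.tm (.atom a)) (.atom a)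
  | bot (X) : RightIntro [⟨X, .nul .I⟩] X .bot
  | top : RightIntro [] (.nul .I) .top
  | and (X Y A B) : RightIntro [⟨X, .tm A⟩, ⟨Y, .tm B⟩] (.bin .semi X Y) (.and A B)
  | or (X A B) : RightIntro [⟨X, .bin .semi (.tm A) (.tm B)⟩] X (.or A B)
  | imp (X A B) : RightIntro [⟨X, .bin .gt (.tm A) (.tm B)⟩] X (.imp A B)
  | zero (X) : RightIntro [⟨X, .nul .Phi⟩] X .zero
  | one : RightIntro [] (.nul .Phi) .one
  | fuse (X Y A B) : RightIntro [⟨X, .tm A⟩, ⟨Y, .tm B⟩] (.bin .odot X Y) (.fuse A B)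
  | join (X A B) : RightIntro [⟨X, .bin .comma (.tm A) (.tm B)⟩] X (.join A B)
  | meet (X Y A B) : RightIntro [⟨X, .tm A⟩, ⟨Y, .tm B⟩] (.bin .comma X Y) (.meet A B)
  | dia (X A) : RightIntro [⟨X, .tm A⟩] (.un .circ X) (.dia A)
  | cap (X A B) : RightIntro [⟨X, .bin .tri (.tm A) (.tm B)⟩] X (.cap A B)
  | poss (X A) : RightIntro [⟨X, .tm A⟩] (.un .circR X) (.poss A)
  | get (X A B) : RightIntro [⟨X, .bin .triR (.tm A) (.tm B)⟩] X (.get A B)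

/-- `LeftIntro ps a z`: `a ⊢ z` follows from `ps` by a rule in which `a` is principal. -/
inductive LeftIntro : List (Sequent P Q) → {t : Ty} → Tm P Q t → Structure P Q t → Prop
  | prop (p) : LeftIntro [] (.prop p) (.tm (.prop p))
  | atom (a) : LeftIntro [] (.atom a) (.tm (.atom a))
  | bot : LeftIntro [] .bot (.nul .I)
  | top (X) : LeftIntro [⟨.nul .I, X⟩] .top X
  | and (X A B) : LeftIntro [⟨.bin .semi (.tm A) (.tm B), X⟩] (.and A B) X
  | or (X Y A B) : LeftIntro [⟨.tm A, X⟩, ⟨.tm B, Y⟩] (.or A B) (.bin .semi X Y)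
  | imp (X Y A B) : LeftIntro [⟨X, .tm A⟩, ⟨.tm B, Y⟩] (.imp A B) (.bin .gt X Y)
  | zero : LeftIntro [] .zero (.nul .Phi)
  | one (X) : LeftIntro [⟨.nul .Phi, X⟩] .one X
  | fuse (X A B) : LeftIntro [⟨.bin .odot (.tm A) (.tm B), X⟩] (.fuse A B) X
  | join (X Y A B) : LeftIntro [⟨.tm A, X⟩, ⟨.tm B, Y⟩] (.join A B) (.bin .comma X Y)
  | meet (X A B) : LeftIntro [⟨.bin .comma (.tm A) (.tm B), X⟩] (.meet A B) X
  | dia (X A) : LeftIntro [⟨.un .circ (.tm A), X⟩] (.dia A) X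
  | cap (X Y A B) : LeftIntro [⟨X, .tm A⟩, ⟨.tm B, Y⟩] (.cap A B) (.bin .tri X Y)
  | poss (X A) : LeftIntro [⟨.un .circR (.tm A), X⟩] (.poss A) X
  | get (X Y A B) : LeftIntro [⟨X, .tm A⟩, ⟨.tm B, Y⟩] (.get A B) (.bin .triR X Y)

/-- Display postulates and structural rules contain no terms, so a principal term comes from a
logical rule. The tables `RightIntro` and `LeftIntro` reduce the analysis of principal cuts to one
pair of introductions for each connective. -/
theorem rightIntro_of_principal {R : Rule P Q} (hR : R ∈ (calculus P Q).rules)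
    {J : Inference P Q} (hJ : J ∈ R) {t : Ty} {a : Tm P Q t} (h : J.Principal (suc, []) suc a) :
    ∃ x : Structure P Q t, J.concl = ⟨x, .tm a⟩ ∧ RightIntro J.prems x a := by
  rcases hR with hR | hR
  · obtain ⟨s, hs, rfl⟩ := exists_stepRule hR
    exact absurd h (not_principal_of_stepRule hs hJ _ _ _)
  · simp only [logicalRules, Set.mem_insert_iff, Set.mem_singleton_iff] at hR
    rcases hR with (rfl | rfl | rfl | rfl | rfl | rfl | rfl | rfl | rfl | rfl | rfl | rfl | rfl |
      rfl | rfl | rfl | rfl | rfl | rfl | rfl | rfl | rfl | rfl | rfl | rfl | rfl | rfl | rfl |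
      rfl | rfl) <;>
    · obtain ⟨i, σ, rfl⟩ := hJ
      cases Schema.principal_iff.1 h <;> exact ⟨_, rfl, by constructor⟩

theorem leftIntro_of_principal {R : Rule P Q} (hR : R ∈ (calculus P Q).rules)
    {J : Inference P Q} (hJ : J ∈ R) {t : Ty} {a : Tm P Q t} (h : J.Principal (pre, []) pre a) :
    ∃ z : Structure P Q t, J.concl = ⟨.tm a, z⟩ ∧ LeftIntro J.prems a z := by
  rcases hR with hR | hR
  · obtain ⟨s, hs, rfl⟩ := exists_stepRule hR
    exact absurd h (not_principal_of_stepRule hs hJ _ _ _)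
  · simp only [logicalRules, Set.mem_insert_iff, Set.mem_singleton_iff] at hR
    rcases hR with (rfl | rfl | rfl | rfl | rfl | rfl | rfl | rfl | rfl | rfl | rfl | rfl | rfl |
      rfl | rfl | rfl | rfl | rfl | rfl | rfl | rfl | rfl | rfl | rfl | rfl | rfl | rfl | rfl |
      rfl | rfl) <;>
    · obtain ⟨i, σ, rfl⟩ := hJ
      cases Schema.principal_iff.1 h <;> exact ⟨_, rfl, by constructor⟩

theorem isAxiom_cases {S : Sequent P Q} (h : (calculus P Q).IsAxiom S) :
    (∃ p, S = ⟨.tm (.prop p), .tm (.prop p)⟩) ∨ (∃ a, S = ⟨.tm (.atom a), .tm (.atom a)⟩) ∨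
      S = ⟨.tm .bot, .nul .I⟩ ∨ S = ⟨.nul .I, .tm .top⟩ ∨ S = ⟨.tm .zero, .nul .Phi⟩ ∨
      S = ⟨.nul .Phi, .tm .one⟩ := by
  obtain ⟨R, hR, J, hJ, hp, rfl⟩ := h
  rcases hR with hR | hR
  · obtain ⟨s, hs, rfl⟩ := exists_stepRule hR
    exact absurd hp (prems_of_stepRule hJ)
  · simp only [logicalRules, Set.mem_insert_iff, Set.mem_singleton_iff] at hR
    rcases hR with (rfl | rfl | rfl | rfl | rfl | rfl | rfl | rfl | rfl | rfl | rfl | rfl | rfl |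
      rfl | rfl | rfl | rfl | rfl | rfl | rfl | rfl | rfl | rfl | rfl | rfl | rfl | rfl | rfl |
      rfl | rfl) <;> obtain ⟨i, σ, rfl⟩ := hJ <;> first | (cases hp; done) | skip
    · exact .inl ⟨_, rfl⟩
    · exact .inr (.inl ⟨_, rfl⟩)
    · exact .inr (.inr (.inl rfl))
    · exact .inr (.inr (.inr (.inl rfl)))
    · exact .inr (.inr (.inr (.inr (.inl rfl))))
    · exact .inr (.inr (.inr (.inr (.inr rfl))))

end

section
variable {P : Type u} {Q : Type v}

/-! ### Derivability with restricted cuts -/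

/-- Derivability from `H` by means of cuts satisfying `q`. -/
def DerivableBy (H : Set (Sequent P Q)) (q : Cut P Q → Prop) (S : Sequent P Q) : Prop :=
  ∃ d : Derivation (calculus P Q) H S, d.AllCuts q

variable {H : Set (Sequent P Q)} {q : Cut P Q → Prop}

theorem DerivableBy.hyp {S : Sequent P Q} (h : S ∈ H) : DerivableBy H q S :=
  ⟨.hyp h, trivial⟩

theorem DerivableBy.rule {R : Rule P Q} (hR : R ∈ (calculus P Q).rules) {J : Inference P Q}
    (hJ : J ∈ R) (h : ∀ S ∈ J.prems, DerivableBy H q S) : DerivableBy H q J.concl := by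
  choose d hd using fun i : Fin J.prems.length => h _ (J.prems.get_mem i)
  exact ⟨.rule hR hJ d, hd⟩

theorem DerivableBy.cut {R : Set (Cut P Q)} (hR : R ∈ (calculus P Q).cuts) {K : Cut P Q}
    (hK : K ∈ R) (hq : q K) (h1 : DerivableBy H q K.left) (h2 : DerivableBy H q K.right) :
    DerivableBy H q K.concl := by
  obtain ⟨d, hd⟩ := h1
  obtain ⟨e, he⟩ := h2
  exact ⟨.cut hR hK d e, hq, hd, he⟩

/-- The index is the position in the list `displayPairs`. -/
theorem DerivableBy.display (i : Fin 15) (σ : (t : Ty) → ℕ → Structure P Q t) :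
    DerivableBy H q (((displayPairs P Q).get i).1.subst σ) ↔
      DerivableBy H q (((displayPairs P Q).get i).2.subst σ) := by
  have hm := (displayPairs P Q).get_mem i
  constructor
  · intro h
    refine DerivableBy.rule (R := stepRule P Q ((displayPairs P Q).get i))
      (J := Schema.inst ⟨[((displayPairs P Q).get i).1], ((displayPairs P Q).get i).2⟩ σ)
      (.inl (.inl ⟨_, hm, .inl rfl⟩)) ⟨(), σ, rfl⟩ fun S hS => ?_
    rw [List.mem_singleton.1 hS]
    exact h
  · intro h
    refine DerivableBy.rule (R := stepRule P Q ((displayPairs P Q).get i).swap)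
      (J := Schema.inst ⟨[((displayPairs P Q).get i).2], ((displayPairs P Q).get i).1⟩ σ)
      (.inl (.inl ⟨_, hm, .inr rfl⟩)) ⟨(), σ, rfl⟩ fun S hS => ?_
    rw [List.mem_singleton.1 hS]
    exact h

/-- The assignment of the given structures to the first three variables of each type. -/
def assign (X Y Z : Structure P Q fm) (Γ Δ Ξ : Structure P Q res) :
    (t : Ty) → ℕ → Structure P Q t
  | fm, 0 => X
  | fm, 1 => Y
  | fm, _ => Z
  | res, 0 => Γ
  | res, 1 => Δ
  | res, _ => Ξ

section display
variable {X Y Z : Structure P Q fm} {Γ Δ Ξ : Structure P Q res}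

/-- In this and the following instances, `I` and `Φ` are dummy values for variables that do not
occur in the postulate. -/
theorem DerivableBy.semi_gt : DerivableBy H q ⟨.bin .semi X Y, Z⟩ ↔
    DerivableBy H q ⟨Y, .bin .gt X Z⟩ :=
  DerivableBy.display 0 (assign X Y Z (.nul .Phi) (.nul .Phi) (.nul .Phi))

theorem DerivableBy.gt_semi : DerivableBy H q ⟨Z, .bin .semi X Y⟩ ↔
    DerivableBy H q ⟨.bin .gt X Z, Y⟩ :=
  DerivableBy.display 1 (assign X Y Z (.nul .Phi) (.nul .Phi) (.nul .Phi))

theorem DerivableBy.semi_lt : DerivableBy H q ⟨.bin .semi X Y, Z⟩ ↔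
    DerivableBy H q ⟨X, .bin .lt Z Y⟩ :=
  DerivableBy.display 2 (assign X Y Z (.nul .Phi) (.nul .Phi) (.nul .Phi))

theorem DerivableBy.lt_semi : DerivableBy H q ⟨Z, .bin .semi X Y⟩ ↔
    DerivableBy H q ⟨.bin .lt Z Y, X⟩ :=
  DerivableBy.display 3 (assign X Y Z (.nul .Phi) (.nul .Phi) (.nul .Phi))

theorem DerivableBy.comma_sqR : DerivableBy H q ⟨.bin .comma Γ Δ, Ξ⟩ ↔
    DerivableBy H q ⟨Δ, .bin .sqR Γ Ξ⟩ :=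
  DerivableBy.display 4 (assign (.nul .I) (.nul .I) (.nul .I) Γ Δ Ξ)

theorem DerivableBy.comma_sqL : DerivableBy H q ⟨.bin .comma Γ Δ, Ξ⟩ ↔
    DerivableBy H q ⟨Γ, .bin .sqL Ξ Δ⟩ :=
  DerivableBy.display 5 (assign (.nul .I) (.nul .I) (.nul .I) Γ Δ Ξ)

theorem DerivableBy.sqR_comma : DerivableBy H q ⟨Γ, .bin .comma Δ Ξ⟩ ↔
    DerivableBy H q ⟨.bin .sqR Δ Γ, Ξ⟩ :=
  DerivableBy.display 6 (assign (.nul .I) (.nul .I) (.nul .I) Γ Δ Ξ)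

theorem DerivableBy.sqL_comma : DerivableBy H q ⟨Γ, .bin .comma Δ Ξ⟩ ↔
    DerivableBy H q ⟨.bin .sqL Γ Ξ, Δ⟩ :=
  DerivableBy.display 7 (assign (.nul .I) (.nul .I) (.nul .I) Γ Δ Ξ)

theorem DerivableBy.odot_resR : DerivableBy H q ⟨.bin .odot Γ Δ, Ξ⟩ ↔
    DerivableBy H q ⟨Δ, .bin .resR Γ Ξ⟩ :=
  DerivableBy.display 8 (assign (.nul .I) (.nul .I) (.nul .I) Γ Δ Ξ)

theorem DerivableBy.odot_resL : DerivableBy H q ⟨.bin .odot Γ Δ, Ξ⟩ ↔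
    DerivableBy H q ⟨Γ, .bin .resL Ξ Δ⟩ :=
  DerivableBy.display 9 (assign (.nul .I) (.nul .I) (.nul .I) Γ Δ Ξ)

theorem DerivableBy.circ_bull : DerivableBy H q ⟨.un .circ X, Y⟩ ↔
    DerivableBy H q ⟨X, .un .bull Y⟩ :=
  DerivableBy.display 10 (assign X Y (.nul .I) (.nul .Phi) (.nul .Phi) (.nul .Phi))

theorem DerivableBy.circR_bullR : DerivableBy H q ⟨.un .circR Γ, X⟩ ↔
    DerivableBy H q ⟨Γ, .un .bullR X⟩ :=
  DerivableBy.display 11 (assign X (.nul .I) (.nul .I) Γ (.nul .Phi) (.nul .Phi))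

theorem DerivableBy.tri_btri : DerivableBy H q ⟨X, .bin .tri Γ Y⟩ ↔
    DerivableBy H q ⟨Γ, .bin .btri X Y⟩ :=
  DerivableBy.display 12 (assign X Y (.nul .I) Γ (.nul .Phi) (.nul .Phi))

theorem DerivableBy.triR_up : DerivableBy H q ⟨X, .bin .triR Γ Δ⟩ ↔
    DerivableBy H q ⟨.bin .up Γ X, Δ⟩ :=
  DerivableBy.display 13 (assign X (.nul .I) (.nul .I) Γ Δ (.nul .Phi))

theorem DerivableBy.triR_btriR : DerivableBy H q ⟨X, .bin .triR Γ Δ⟩ ↔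
    DerivableBy H q ⟨Γ, .bin .btriR X Δ⟩ :=
  DerivableBy.display 14 (assign X (.nul .I) (.nul .I) Γ Δ (.nul .Phi))

end display

/-! ### Principal cuts -/

/-- Strongly type-uniform cuts on proper subterms of `b`. -/
def ReducedCut (b : AnyTm P Q) (K : Cut P Q) : Prop :=
  K.StronglyTypeUniform ∧ ProperSubterm ⟨K.ty, K.term⟩ b

/-- The ordinary cut, with the cut term in display. -/
theorem DerivableBy.cut_display {b : AnyTm P Q} {t : Ty} {a : Tm P Q t}
    (hab : ImmSub ⟨t, a⟩ b) {x z : Structure P Q t} (h1 : DerivableBy H (ReducedCut b) ⟨x, .tm a⟩)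
    (h2 : DerivableBy H (ReducedCut b) ⟨.tm a, z⟩) : DerivableBy H (ReducedCut b) ⟨x, z⟩ := by
  let K : Cut P Q := ⟨⟨x, .tm a⟩, (suc, []), t, a, z, .here _⟩
  have hK : K.concl = ⟨x, z⟩ := by
    simp [Cut.concl, K, Seq.replace_suc]
  have hq : ReducedCut b K := by
    refine ⟨⟨t, ?_⟩, .single hab⟩
    simp [hK]
    simp [K, Cut.right]
  rw [← hK]
  cases t
  · exact .cut (R := fmCut P Q) (.inl rfl) (K := K) ⟨rfl, rfl, rfl⟩ hq h1 h2
  · exact .cut (R := resCut P Q) (.inr rfl) (K := K) ⟨rfl, rfl, rfl, rfl⟩ hq h1 h2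

/-- The surgical cut in the second coordinate of a structural `▷`. -/
theorem DerivableBy.cut_tri {b : AnyTm P Q} {A : Tm P Q fm} (hab : ImmSub ⟨fm, A⟩ b)
    {X Z : Structure P Q fm} {Γ : Structure P Q res}
    (h1 : DerivableBy H (ReducedCut b) ⟨X, .bin .tri Γ (.tm A)⟩)
    (h2 : DerivableBy H (ReducedCut b) ⟨.tm A, Z⟩) :
    DerivableBy H (ReducedCut b) ⟨X, .bin .tri Γ Z⟩ := by
  let K : Cut P Q :=
    ⟨⟨X, .bin .tri Γ (.tm A)⟩, (suc, [.snd]), fm, A, Z, .snd Bin.tri (.here _)⟩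
  have hK : K.concl = ⟨X, .bin .tri Γ Z⟩ := by
    simp [Cut.concl, K, Seq.replace_suc, Str.replace_bin, Str.replace_false]
  have hq : ReducedCut b K := by
    refine ⟨⟨fm, ?_⟩, .single hab⟩
    simp [hK]
    simp [K, Cut.right]
  rw [← hK]
  exact .cut (R := fmCut P Q) (.inl rfl) (K := K) ⟨rfl, rfl, rfl⟩ hq h1 h2

/-- For the units, the conclusion is a premise of one of the two introductions; for atoms, it is an
identity axiom. For other connectives, one introduction has the structural counterpart of the
connective applied to the subterms: each subterm is displayed, cut against the matching premise of
the other introduction, and put back. -/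
theorem derivableBy_of_intro {ps qs : List (Sequent P Q)} {t : Ty} {a : Tm P Q t}
    {x z : Structure P Q t} (h1 : RightIntro ps x a) (h2 : LeftIntro qs a z) :
    DerivableBy {S | S ∈ ps ∨ S ∈ qs} (ReducedCut ⟨t, a⟩) ⟨x, z⟩ := by
  -- Any assignment will do, since the identity axioms contain no variables.
  have σ : (t : Ty) → ℕ → Structure P Q t :=
    assign (.nul .I) (.nul .I) (.nul .I) (.nul .Phi) (.nul .Phi) (.nul .Phi)
  cases h1 with
  | prop p =>
    cases h2
    exact .rule (R := ruleOf fun p : P => ⟨[], ⟨.tm (.prop p), .tm (.prop p)⟩⟩)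
      (J := Schema.inst ⟨[], ⟨.tm (.prop p), .tm (.prop p)⟩⟩ σ)
      (.inr (.inl rfl)) ⟨p, _, rfl⟩ (by simp [Schema.inst])
  | atom p =>
    cases h2
    exact .rule (R := ruleOf fun p : Q => ⟨[], ⟨.tm (.atom p), .tm (.atom p)⟩⟩)
      (J := Schema.inst ⟨[], ⟨.tm (.atom p), .tm (.atom p)⟩⟩ σ)
      (.inr (.inr (.inl rfl))) ⟨p, _, rfl⟩ (by simp [Schema.inst])
  | bot X => cases h2; exact .hyp (by simp)
  | top => cases h2; exact .hyp (by simp)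
  | zero X => cases h2; exact .hyp (by simp)
  | one => cases h2; exact .hyp (by simp)
  | and X Y A B =>
    cases h2 with | and Z =>
    have hA : ImmSub ⟨_, A⟩ (⟨_, .and A B⟩ : AnyTm P Q) := by simp [ImmSub, Tm.children]
    have hB : ImmSub ⟨_, B⟩ (⟨_, .and A B⟩ : AnyTm P Q) := by simp [ImmSub, Tm.children]
    refine DerivableBy.semi_gt.2 (.cut_display hB (.hyp (by simp)) (DerivableBy.semi_gt.1 ?_))
    exact DerivableBy.semi_lt.2 (.cut_display hA (.hyp (by simp))
      (DerivableBy.semi_lt.1 (.hyp (by simp))))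
  | or X A B =>
    cases h2 with | or Y Z =>
    have hA : ImmSub ⟨_, A⟩ (⟨_, .or A B⟩ : AnyTm P Q) := by simp [ImmSub, Tm.children]
    have hB : ImmSub ⟨_, B⟩ (⟨_, .or A B⟩ : AnyTm P Q) := by simp [ImmSub, Tm.children]
    refine DerivableBy.gt_semi.2 (.cut_display hB (DerivableBy.gt_semi.1 ?_) (.hyp (by simp)))
    exact DerivableBy.lt_semi.2 (.cut_display hA (DerivableBy.lt_semi.1 (.hyp (by simp)))
      (.hyp (by simp)))
  | imp X A B =>
    cases h2 with | imp Y Z =>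
    have hA : ImmSub ⟨_, A⟩ (⟨_, .imp A B⟩ : AnyTm P Q) := by simp [ImmSub, Tm.children]
    have hB : ImmSub ⟨_, B⟩ (⟨_, .imp A B⟩ : AnyTm P Q) := by simp [ImmSub, Tm.children]
    refine DerivableBy.semi_gt.1 (DerivableBy.semi_lt.2
      (.cut_display hA (.hyp (by simp)) (DerivableBy.semi_lt.1 ?_)))
    exact .cut_display hB (DerivableBy.semi_gt.2 (.hyp (by simp))) (.hyp (by simp))
  | fuse X Y A B =>
    cases h2 with | fuse Z =>
    have hA : ImmSub ⟨_, A⟩ (⟨_, .fuse A B⟩ : AnyTm P Q) := by simp [ImmSub, Tm.children]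
    have hB : ImmSub ⟨_, B⟩ (⟨_, .fuse A B⟩ : AnyTm P Q) := by simp [ImmSub, Tm.children]
    refine DerivableBy.odot_resR.2
      (.cut_display hB (.hyp (by simp)) (DerivableBy.odot_resR.1 ?_))
    exact DerivableBy.odot_resL.2 (.cut_display hA (.hyp (by simp))
      (DerivableBy.odot_resL.1 (.hyp (by simp))))
  | join X A B =>
    cases h2 with | join Y Z =>
    have hA : ImmSub ⟨_, A⟩ (⟨_, .join A B⟩ : AnyTm P Q) := by simp [ImmSub, Tm.children]
    have hB : ImmSub ⟨_, B⟩ (⟨_, .join A B⟩ : AnyTm P Q) := by simp [ImmSub, Tm.children]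
    refine DerivableBy.sqR_comma.2
      (.cut_display hB (DerivableBy.sqR_comma.1 ?_) (.hyp (by simp)))
    exact DerivableBy.sqL_comma.2 (.cut_display hA (DerivableBy.sqL_comma.1 (.hyp (by simp)))
      (.hyp (by simp)))
  | meet X Y A B =>
    cases h2 with | meet Z =>
    have hA : ImmSub ⟨_, A⟩ (⟨_, .meet A B⟩ : AnyTm P Q) := by simp [ImmSub, Tm.children]
    have hB : ImmSub ⟨_, B⟩ (⟨_, .meet A B⟩ : AnyTm P Q) := by simp [ImmSub, Tm.children]
    refine DerivableBy.comma_sqR.2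
      (.cut_display hB (.hyp (by simp)) (DerivableBy.comma_sqR.1 ?_))
    exact DerivableBy.comma_sqL.2 (.cut_display hA (.hyp (by simp))
      (DerivableBy.comma_sqL.1 (.hyp (by simp))))
  | dia X A =>
    cases h2 with | dia Z =>
    have hA : ImmSub ⟨_, A⟩ (⟨_, .dia A⟩ : AnyTm P Q) := by simp [ImmSub, Tm.children]
    exact DerivableBy.circ_bull.2 (.cut_display hA (.hyp (by simp))
      (DerivableBy.circ_bull.1 (.hyp (by simp))))
  | cap X A B =>
    cases h2 with | cap Y Z =>
    have hA : ImmSub ⟨_, A⟩ (⟨_, .cap A B⟩ : AnyTm P Q) := by simp [ImmSub, Tm.children]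
    have hB : ImmSub ⟨_, B⟩ (⟨_, .cap A B⟩ : AnyTm P Q) := by simp [ImmSub, Tm.children]
    -- The resource `A` can be displayed through `▶` and cut as usual. The formula `B` in the second
    -- coordinate of `▷` cannot be displayed, unlike in the barred case where `triR_up` does this,
    -- so the cut on it is surgical.
    refine .cut_tri hB (DerivableBy.tri_btri.2 ?_) (.hyp (by simp))
    exact .cut_display hA (.hyp (by simp)) (DerivableBy.tri_btri.1 (.hyp (by simp)))
  | poss X A =>
    cases h2 with | poss Z =>
    have hA : ImmSub ⟨_, A⟩ (⟨_, .poss A⟩ : AnyTm P Q) := by simp [ImmSub, Tm.children]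
    exact DerivableBy.circR_bullR.2 (.cut_display hA (.hyp (by simp))
      (DerivableBy.circR_bullR.1 (.hyp (by simp))))
  | get X A B =>
    cases h2 with | get Y Z =>
    have hA : ImmSub ⟨_, A⟩ (⟨_, .get A B⟩ : AnyTm P Q) := by simp [ImmSub, Tm.children]
    have hB : ImmSub ⟨_, B⟩ (⟨_, .get A B⟩ : AnyTm P Q) := by simp [ImmSub, Tm.children]
    refine DerivableBy.triR_up.2 (.cut_display hB (DerivableBy.triR_up.1 ?_) (.hyp (by simp)))
    exact DerivableBy.triR_btriR.2 (.cut_display hA (.hyp (by simp))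
      (DerivableBy.triR_btriR.1 (.hyp (by simp))))

/-- Condition C₈'. -/
theorem derivableBy_of_principal {K : Cut P Q} {R₁ : Rule P Q} (hR₁ : R₁ ∈ (calculus P Q).rules)
    {J₁ : Inference P Q} (hJ₁ : J₁ ∈ R₁) {R₂ : Rule P Q} (hR₂ : R₂ ∈ (calculus P Q).rules)
    {J₂ : Inference P Q} (hJ₂ : J₂ ∈ R₂) (h1 : J₁.concl = K.left)
    (h1' : J₁.Principal K.pos suc K.term) (h2 : J₂.concl = K.right)
    (h2' : J₂.Principal (pre, []) pre K.term) :
    DerivableBy {S | S ∈ J₁.prems ∨ S ∈ J₂.prems} (ReducedCut ⟨K.ty, K.term⟩) K.concl := by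
  -- Principal terms, those of axioms included, are in display, so a principal cut is never properly
  -- surgical.
  have hpos : K.pos = (suc, []) := by
    obtain ⟨s, σ, hs, rfl, -⟩ := goodRule hR₁ J₁ hJ₁
    exact hs.display (Schema.principal_iff.1 h1')
  rw [hpos] at h1'
  obtain ⟨x, hx, hi⟩ := rightIntro_of_principal hR₁ hJ₁ h1'
  obtain ⟨z, hz, hi'⟩ := leftIntro_of_principal hR₂ hJ₂ h2'
  have hzK : z = K.z := by
    have := hz.symm.trans h2
    simp only [Cut.right, Seq.mk.injEq, heq_eq_eq, true_and] at this
    exact this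
  have hc : K.concl = ⟨x, z⟩ := by
    rw [Cut.concl, hpos, ← h1, hx, Seq.replace_suc, hzK]
    simp
  rw [hc]
  exact derivableBy_of_intro hi hi'

end

section
variable {P : Type u} {Q : Type v}

/-! ### Replacement of some occurrences of a term -/

/-- `Str.Repl a z κ π x x'`: if `x` is a `π`-part, then `x'` arises from it by putting `z` in place
of some occurrences of `a` as a `κ`-part. -/
inductive Str.Repl {w : Ty} (a : Tm P Q w) (z : Structure P Q w) (κ : Part) :
    {t : Ty} → Part → Structure P Q t → Structure P Q t → Prop
  | here : Str.Repl a z κ κ (.tm a) z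
  | refl {t : Ty} (π : Part) (x : Structure P Q t) : Str.Repl a z κ π x x
  | un {s t : Ty} {π : Part} (c : Un s t) {x x' : Structure P Q s} :
      Str.Repl a z κ π x x' → Str.Repl a z κ π (.un c x) (.un c x')
  | bin {s t k : Ty} {π : Part} (c : Bin s t k) {x x' : Structure P Q s} {y y' : Structure P Q t} :
      Str.Repl a z κ (c.fstPart π) x x' → Str.Repl a z κ (c.sndPart π) y y' →
        Str.Repl a z κ π (.bin c x y) (.bin c x' y')

/-- `S'` arises from `S` by putting `z` in place of some occurrences of `a` as a `κ`-part. -/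
inductive Seq.Repl {w : Ty} (a : Tm P Q w) (z : Structure P Q w) (κ : Part) :
    Sequent P Q → Sequent P Q → Prop
  | mk {s t : Ty} {x x' : Structure P Q s} {y y' : Structure P Q t} :
      Str.Repl a z κ pre x x' → Str.Repl a z κ suc y y' → Seq.Repl a z κ ⟨x, y⟩ ⟨x', y'⟩

theorem Str.repl_replace {t w : Ty} {π κ : Part} {x : Structure P Q t} {p : Path} {a : Tm P Q w}
    (z : Structure P Q w) (h : x.sub π p = some (κ, ⟨w, .tm a⟩)) :
    Str.Repl a z κ π x (Str.replace z x fun q => q = p) := by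
  induction x generalizing π p with
  | un c x ih =>
    rcases p with _ | ⟨_ | _, p⟩
    · simp at h; obtain ⟨_, rfl, h⟩ := h; cases h
    · simpa [Str.replace_un] using .un c (ih h)
    · simp at h
  | bin c x y ihx ihy =>
    rcases p with _ | ⟨_ | _, p⟩
    · simp at h; obtain ⟨_, rfl, h⟩ := h; cases h
    · simpa [Str.replace_bin, Str.replace_false] using .bin c (ihx h) (.refl _ y)
    · simpa [Str.replace_bin, Str.replace_false] using .bin c (.refl _ x) (ihy h)
  | _ =>
    rcases p with _ | ⟨_, p⟩
    · simp only [Str.sub_nil, Option.some.injEq, Prod.mk.injEq, Sigma.mk.injEq] at h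
      obtain ⟨rfl, rfl, h⟩ := h
      cases h
      try simpa using .here
    · simp at h

/-- A cut is the case of one replaced occurrence, so admissibility of `Seq.Repl` covers ordinary and
surgical cuts alike. -/
theorem Cut.repl_concl (K : Cut P Q) : Seq.Repl K.term K.z suc K.left K.concl := by
  have h := K.sub_pos
  unfold Cut.concl
  generalize K.pos = o at h
  obtain ⟨_ | _, p⟩ := o
  · rw [Seq.replace_pre]
    exact .mk (Str.repl_replace _ h) (.refl _ _)
  · rw [Seq.replace_suc]
    exact .mk (.refl _ _) (Str.repl_replace _ h)

section subst
variable {t w : Ty} {a : Tm P Q w} {z : Structure P Q w} {κ π : Part}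
  {σ σ' : (t : Ty) → ℕ → Structure P Q t}

theorem Str.mem_vars_un {s : Ty} {c : Un s t} {x : Str P Q ℕ s} {v : (Ty × ℕ) × Part × Path}
    (h : v ∈ x.vars π) : (v.1, v.2.1, Dir.fst :: v.2.2) ∈ (Str.un c x).vars π :=
  List.mem_map.2 ⟨v, h, rfl⟩

theorem Str.mem_vars_fst {s k : Ty} {c : Bin s t k} {x : Str P Q ℕ s} {y : Str P Q ℕ t}
    {v : (Ty × ℕ) × Part × Path} (h : v ∈ x.vars (c.fstPart π)) :
    (v.1, v.2.1, Dir.fst :: v.2.2) ∈ (Str.bin c x y).vars π :=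
  List.mem_append_left _ (List.mem_map.2 ⟨v, h, rfl⟩)

theorem Str.mem_vars_snd {s k : Ty} {c : Bin s t k} {x : Str P Q ℕ s} {y : Str P Q ℕ t}
    {v : (Ty × ℕ) × Part × Path} (h : v ∈ y.vars (c.sndPart π)) :
    (v.1, v.2.1, Dir.snd :: v.2.2) ∈ (Str.bin c x y).vars π :=
  List.mem_append_right _ (List.mem_map.2 ⟨v, h, rfl⟩)

theorem Seq.mem_vars_ante {S : Seq P Q ℕ} {v : (Ty × ℕ) × Part × Path} (h : v ∈ S.ante.vars pre) :
    (v.1, v.2.1, (pre, v.2.2)) ∈ S.vars :=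
  List.mem_append_left _ (List.mem_map.2 ⟨v, h, rfl⟩)

theorem Seq.mem_vars_cons {S : Seq P Q ℕ} {v : (Ty × ℕ) × Part × Path} (h : v ∈ S.cons.vars suc) :
    (v.1, v.2.1, (suc, v.2.2)) ∈ S.vars :=
  List.mem_append_right _ (List.mem_map.2 ⟨v, h, rfl⟩)

theorem Str.subst_congr {x : Str P Q ℕ t}
    (h : ∀ v ∈ x.vars π, σ v.1.1 v.1.2 = σ' v.1.1 v.1.2) : x.subst σ = x.subst σ' := by
  induction x generalizing π with
  | var n => exact h _ (List.mem_singleton.2 rfl)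
  | un c x ih =>
    simp only [Str.subst]
    rw [ih fun v hv => (h _ (Str.mem_vars_un hv) :)]
  | bin c x y ihx ihy =>
    simp only [Str.subst]
    rw [ihx fun v hv => (h _ (Str.mem_vars_fst hv) :),
      ihy fun v hv => (h _ (Str.mem_vars_snd hv) :)]
  | _ => rfl

theorem Str.repl_subst {x : Str P Q ℕ t}
    (h : ∀ v ∈ x.vars π, Str.Repl a z κ v.2.1 (σ v.1.1 v.1.2) (σ' v.1.1 v.1.2)) :
    Str.Repl a z κ π (x.subst σ) (x.subst σ') := by
  induction x generalizing π with
  | var n => exact h _ (List.mem_singleton.2 rfl)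
  | un c x ih => exact .un c (ih fun v hv => (h _ (Str.mem_vars_un hv) :))
  | bin c x y ihx ihy =>
    exact .bin c (ihx fun v hv => (h _ (Str.mem_vars_fst hv) :))
      (ihy fun v hv => (h _ (Str.mem_vars_snd hv) :))
  | _ => exact .refl _ _

theorem Seq.repl_subst {S : Seq P Q ℕ}
    (h : ∀ v ∈ S.vars, Str.Repl a z κ v.2.1 (σ v.1.1 v.1.2) (σ' v.1.1 v.1.2)) :
    Seq.Repl a z κ (S.subst σ) (S.subst σ') :=
  .mk (Str.repl_subst fun _ hv => (h _ (Seq.mem_vars_ante hv) :))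
    (Str.repl_subst fun _ hv => (h _ (Seq.mem_vars_cons hv) :))

/-- Two assignments can be combined along disjoint sets of variables. -/
theorem exists_combine (l l' : List (Ty × ℕ)) (h : l.Disjoint l')
    (σ σ' : (t : Ty) → ℕ → Structure P Q t) : ∃ τ : (t : Ty) → ℕ → Structure P Q t,
      (∀ k ∈ l, σ k.1 k.2 = τ k.1 k.2) ∧ ∀ k ∈ l', σ' k.1 k.2 = τ k.1 k.2 := by
  classical
  refine ⟨fun t n => if (t, n) ∈ l then σ t n else σ' t n, fun k hk => ?_, fun k hk => ?_⟩
  · simp [hk]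
  · have : k ∉ l := fun hk' => h hk' hk
    simp [this]

/-- Replacement in an instance of a linear pattern without terms is replacement in the structures
substituted for its variables. -/
theorem Str.exists_subst_of_repl {x : Str P Q ℕ t} (hx : x.tms = [])
    (hl : ((x.vars π).map Prod.fst).Nodup) {x' : Structure P Q t}
    (h : Str.Repl a z κ π (x.subst σ) x') : ∃ σ', x' = x.subst σ' ∧
      ∀ v ∈ x.vars π, Str.Repl a z κ v.2.1 (σ v.1.1 v.1.2) (σ' v.1.1 v.1.2) := by
  induction x generalizing π with
  | @var k n =>
    classical
    -- The assignment is altered at every variable of type `k`, which is harmless because `n` is the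
    -- only variable of the pattern.
    refine ⟨fun t m => if h : k = t then h ▸ x' else σ t m, by simp [Str.subst], ?_⟩
    have h : Str.Repl a z κ π (σ k n) x' := h
    simpa [Str.vars] using h
  | tm b => simp [Str.tms] at hx
  | nul c =>
    generalize hu : (Str.nul c : Str P Q ℕ _).subst σ = u at h
    cases h with
    | refl => exact ⟨σ, hu.symm, by simp [Str.vars]⟩
    | _ => simp [Str.subst] at hu
  | un c x ih =>
    generalize hu : (Str.un c x).subst σ = u at h
    cases h with
    | refl => exact ⟨σ, hu.symm, fun v _ => .refl _ _⟩
    | un c' h =>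
      cases hu
      simp only [Str.vars, List.map_map] at hl
      obtain ⟨σ', rfl, h'⟩ := ih hx hl h
      refine ⟨σ', rfl, fun v hv => ?_⟩
      obtain ⟨u, hm, rfl⟩ := List.mem_map.1 hv
      exact h' u hm
    | _ => simp [Str.subst] at hu
  | bin c x y ihx ihy =>
    generalize hu : (Str.bin c x y).subst σ = u at h
    cases h with
    | refl => exact ⟨σ, hu.symm, fun v _ => .refl _ _⟩
    | bin c' h1 h2 =>
      cases hu
      simp only [Str.vars, List.map_append, List.map_map] at hl
      obtain ⟨hl1, hl2, hd⟩ := List.nodup_append'.1 hl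
      obtain ⟨hx1, hx2⟩ := List.append_eq_nil_iff.1 hx
      obtain ⟨σ1, rfl, h1'⟩ := ihx hx1 hl1 h1
      obtain ⟨σ2, rfl, h2'⟩ := ihy hx2 hl2 h2
      -- The two coordinates share no variable, so the replacements found in them cannot conflict.
      obtain ⟨τ, e1, e2⟩ := exists_combine _ _ hd σ1 σ2
      have f1 : ∀ v ∈ x.vars (c.fstPart π), σ1 v.1.1 v.1.2 = τ v.1.1 v.1.2 :=
        fun v hv => e1 v.1 (List.mem_map_of_mem hv)
      have f2 : ∀ v ∈ y.vars (c.sndPart π), σ2 v.1.1 v.1.2 = τ v.1.1 v.1.2 :=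
        fun v hv => e2 v.1 (List.mem_map_of_mem hv)
      refine ⟨τ, ?_, fun v hv => ?_⟩
      · simp only [Str.subst]
        rw [Str.subst_congr f1, Str.subst_congr f2]
      · rcases List.mem_append.1 hv with hv | hv
        · obtain ⟨u, hm, rfl⟩ := List.mem_map.1 hv
          have := h1' u hm
          rwa [f1 u hm] at this
        · obtain ⟨u, hm, rfl⟩ := List.mem_map.1 hv
          have := h2' u hm
          rwa [f2 u hm] at this
    | _ => simp [Str.subst] at hu

/-- Replacement in one side of the conclusion of a rule. -/
theorem Str.exists_subst_of_repl' {x : Str P Q ℕ t} (hx : x.tms = [] ∨ ∃ b, x = .tm b)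
    (hl : ((x.vars π).map Prod.fst).Nodup) {y : Structure P Q t}
    (h : Str.Repl a z κ π (x.subst σ) y) : ∃ σ',
      (∀ v ∈ x.vars π, Str.Repl a z κ v.2.1 (σ v.1.1 v.1.2) (σ' v.1.1 v.1.2)) ∧
      (y = x.subst σ' ∨ π = κ ∧ (⟨t, x⟩ : Σ t, Str P Q ℕ t) = ⟨w, .tm a⟩ ∧
        (⟨t, y⟩ : Σ t, Structure P Q t) = ⟨w, z⟩) := by
  rcases hx with hx | ⟨b, rfl⟩
  · obtain ⟨σ', h1, h2⟩ := Str.exists_subst_of_repl hx hl h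
    exact ⟨σ', h2, .inl h1⟩
  · refine ⟨σ, fun v _ => .refl _ _, ?_⟩
    simp only [Str.subst] at h
    cases h with
    | here => exact .inr ⟨rfl, rfl, rfl⟩
    | refl => exact .inl rfl

end subst

/-- Replacement in the conclusion of an instance: either it can be made in the premises, or it
also replaces the principal term. -/
theorem Schema.Good.exists_inst_of_repl {s : Schema P Q} (hs : s.Good) {w : Ty} {a : Tm P Q w}
    {z : Structure P Q w} {κ : Part} {σ : (t : Ty) → ℕ → Structure P Q t} {S' : Sequent P Q}
    (h : Seq.Repl a z κ (s.concl.subst σ) S') : ∃ σ' : (t : Ty) → ℕ → Structure P Q t,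
      (∀ S ∈ s.prems, Seq.Repl a z κ (S.subst σ) (S.subst σ')) ∧
      (S' = s.concl.subst σ' ∨
        (κ = pre ∧ ∃ y : Str P Q ℕ w, s.concl = ⟨.tm a, y⟩ ∧ S' = ⟨z, y.subst σ'⟩) ∨
        (κ = suc ∧ ∃ x : Str P Q ℕ w, s.concl = ⟨x, .tm a⟩ ∧ S' = ⟨x.subst σ', z⟩)) := by
  obtain ⟨ps, ⟨x, y⟩⟩ := s
  obtain ⟨hu, hl, hp, ha, hc, -⟩ := hs
  simp only at hu
  subst hu
  generalize hT : Seq.subst σ _ = T at h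
  obtain ⟨h1, h2⟩ := h
  simp only [Seq.subst, Seq.mk.injEq] at hT
  obtain ⟨rfl, rfl, hT1, hT2⟩ := hT
  cases hT1
  cases hT2
  simp only [Seq.vars, List.map_append, List.map_map] at hl
  obtain ⟨hl1, hl2, hd⟩ := List.nodup_append'.1 hl
  obtain ⟨σ1, f1, g1⟩ := Str.exists_subst_of_repl' ha hl1 h1
  obtain ⟨σ2, f2, g2⟩ := Str.exists_subst_of_repl' hc hl2 h2
  obtain ⟨τ, e1, e2⟩ := exists_combine _ _ hd σ1 σ2
  have e1 : ∀ v ∈ x.vars pre, σ1 v.1.1 v.1.2 = τ v.1.1 v.1.2 :=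
    fun v hv => e1 v.1 (List.mem_map_of_mem hv)
  have e2 : ∀ v ∈ y.vars suc, σ2 v.1.1 v.1.2 = τ v.1.1 v.1.2 :=
    fun v hv => e2 v.1 (List.mem_map_of_mem hv)
  rw [Str.subst_congr e1] at g1
  rw [Str.subst_congr e2] at g2
  have key : ∀ v ∈ (Seq.mk x y).vars,
      Str.Repl a z κ v.2.1 (σ v.1.1 v.1.2) (τ v.1.1 v.1.2) := by
    intro v hv
    rcases List.mem_append.1 hv with hv | hv
    · obtain ⟨u, hm, rfl⟩ := List.mem_map.1 hv
      have := f1 u hm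
      rwa [e1 u hm] at this
    · obtain ⟨u, hm, rfl⟩ := List.mem_map.1 hv
      have := f2 u hm
      rwa [e2 u hm] at this
  -- A variable of a premise is the same kind of part in the conclusion, so the replacement made
  -- there is legitimate in the premise as well.
  refine ⟨τ, fun S hS => Seq.repl_subst fun v hv => ?_, ?_⟩
  · obtain ⟨⟨k, ρ, o⟩, h3, h4⟩ := List.mem_map.1 (hp S hS v hv)
    have := key _ h3
    simp only [Prod.mk.injEq] at h4
    obtain ⟨rfl, rfl⟩ := h4
    exact this
  · rcases g1 with rfl | ⟨rfl, g1, g1'⟩ <;> rcases g2 with rfl | ⟨hκ, g2, g2'⟩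
    · exact .inl rfl
    · subst hκ
      simp only [Sigma.mk.injEq] at g2 g2'
      obtain ⟨rfl, g2⟩ := g2
      rw [eq_of_heq g2, eq_of_heq g2'.2]
      exact .inr (.inr ⟨rfl, x, rfl, rfl⟩)
    · simp only [Sigma.mk.injEq] at g1 g1'
      obtain ⟨rfl, g1⟩ := g1
      rw [eq_of_heq g1, eq_of_heq g1'.2]
      exact .inr (.inl ⟨rfl, y, rfl, rfl⟩)
    -- The terms on the two sides are parts of opposite kinds, so they are not both replaced.
    · cases hκ

/-! ### Cut elimination -/

/-- Cut-free derivability. -/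
inductive Prov : Sequent P Q → Prop
  | rule {R : Rule P Q} (hR : R ∈ (calculus P Q).rules) {J : Inference P Q} (hJ : J ∈ R)
      (h : ∀ S ∈ J.prems, Prov S) : Prov J.concl

theorem Prov.exists_cutFree {S : Sequent P Q} (h : Prov S) :
    ∃ d : Derivation (calculus P Q) ∅ S, d.CutFree := by
  induction h with
  | rule hR hJ _ ih => exact DerivableBy.rule hR hJ ih

/-- Cut-free derivability is closed under cuts on `b`. -/
def CutAdmissible (b : AnyTm P Q) : Prop :=
  ∀ z : Structure P Q b.1, Prov ⟨.tm b.2, z⟩ →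
    ∀ S, Prov S → ∀ S', Seq.Repl b.2 z suc S S' → Prov S'

/-- Serves twice: with provable premises as hypotheses it absorbs the reduced cuts of a principal
cut, and with no hypotheses it eliminates all cuts of a derivation. -/
theorem prov_of_derivation {H : Set (Sequent P Q)} (hH : ∀ S ∈ H, Prov S) {S : Sequent P Q}
    (d : Derivation (calculus P Q) H S)
    (hd : d.AllCuts fun K => CutAdmissible ⟨K.ty, K.term⟩) : Prov S := by
  induction d with
  | hyp h => exact hH _ h
  | rule hR hJ ds ih =>
    refine .rule hR hJ fun S hS => ?_
    obtain ⟨i, rfl⟩ := List.get_of_mem hS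
    exact ih i (hd i)
  | cut hR hK d e ihd ihe =>
    exact hd.1 _ (ihe hd.2.2) _ (ihd hd.2.1) _ (Cut.repl_concl _)

theorem Derivation.AllCuts.mono {C : Calculus P Q} {H : Set (Sequent P Q)} {q q' : Cut P Q → Prop}
    (h : ∀ K, q K → q' K) {S : Sequent P Q} {d : Derivation C H S} (hd : d.AllCuts q) :
    d.AllCuts q' := by
  induction d with
  | hyp _ => trivial
  | rule _ _ ds ih => exact fun i => ih i (hd i)
  | cut _ _ d e ihd ihe => exact ⟨h _ hd.1, ihd hd.2.1, ihe hd.2.2⟩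

/-- Replacing the term in precedent position by a structure that may be cut against all its left
introductions. -/
theorem prov_of_repl_pre {t : Ty} {a : Tm P Q t} {x : Structure P Q t}
    (hx : ∀ qs z, LeftIntro qs a z → (∀ S ∈ qs, Prov S) → Prov ⟨x, z⟩) {S : Sequent P Q}
    (hS : Prov S) : ∀ S', Seq.Repl a x pre S S' → Prov S' := by
  induction hS with
  | @rule R hR J hJ _ ih =>
    intro S' hS'
    obtain ⟨s, σ, hs, rfl, hR'⟩ := goodRule hR J hJ
    obtain ⟨σ', h1, h2⟩ := hs.exists_inst_of_repl hS'
    have hp : ∀ S ∈ (s.inst σ').prems, Prov S := by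
      intro S hS
      obtain ⟨T, hT, rfl⟩ := List.mem_map.1 hS
      exact ih _ (List.mem_map_of_mem hT) _ (h1 T hT)
    rcases h2 with rfl | ⟨-, y, hy, rfl⟩ | ⟨h, -⟩
    · exact .rule hR (hR' σ') hp
    -- The principal `a` itself is to be replaced. Once the replacements in the side structures are
    -- made, the inference is still a left introduction of `a`, so `hx` applies to its premises.
    · have hpr : (s.inst σ').Principal (pre, []) pre a := by
        rw [Schema.principal_iff, hy]
        simp
      obtain ⟨z, hz, hi⟩ := leftIntro_of_principal hR (hR' σ') hpr
      have hz' : (⟨.tm a, y.subst σ'⟩ : Sequent P Q) = ⟨.tm a, z⟩ :=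
        (congrArg (Seq.subst σ') hy).symm.trans hz
      simp only [Seq.mk.injEq, heq_eq_eq, true_and] at hz'
      rw [hz']
      exact hx _ _ hi hp
    · cases h

/-- Induction on the proof of `S`, inside which `prov_of_repl_pre` performs the induction on the
proof of `a ⊢ z`. The size of the cut term is the outermost measure. -/
theorem prov_of_repl_suc {t : Ty} {a : Tm P Q t}
    (ih : ∀ b, ProperSubterm b ⟨t, a⟩ → CutAdmissible b) : CutAdmissible ⟨t, a⟩ := by
  intro z hz S hS
  induction hS with
  | @rule R hR J hJ _ ihS =>
    intro S' hS'
    obtain ⟨s, σ, hs, rfl, hR'⟩ := goodRule hR J hJ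
    obtain ⟨σ', h1, h2⟩ := hs.exists_inst_of_repl hS'
    have hp : ∀ S ∈ (s.inst σ').prems, Prov S := by
      intro S hS
      obtain ⟨T, hT, rfl⟩ := List.mem_map.1 hS
      exact ihS _ (List.mem_map_of_mem hT) _ (h1 T hT)
    rcases h2 with rfl | ⟨h, -⟩ | ⟨-, y, hy, rfl⟩
    · exact .rule hR (hR' σ') hp
    · cases h
    -- As the replacements are already made in the premises, `σ'` yields a right introduction of `a`
    -- with provable premises; only the displayed `a` remains to be replaced by `z`.
    · have hpr : (s.inst σ').Principal (suc, []) suc a := by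
        rw [Schema.principal_iff, hy]
        simp
      obtain ⟨x, hx, hi⟩ := rightIntro_of_principal hR (hR' σ') hpr
      have hx' : (⟨y.subst σ', .tm a⟩ : Sequent P Q) = ⟨x, .tm a⟩ :=
        (congrArg (Seq.subst σ') hy).symm.trans hx
      simp only [Seq.mk.injEq, heq_eq_eq, true_and, and_true] at hx'
      rw [hx']
      -- In `a ⊢ z` only the displayed antecedent is replaced by `x`. Its ancestors end at left
      -- introductions of `a`, where both cut terms are principal.
      refine prov_of_repl_pre (a := a) (fun qs z hi' hqs => ?_) hz _ (.mk .here (.refl _ _))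
      obtain ⟨d, hd⟩ := derivableBy_of_intro hi hi'
      exact prov_of_derivation (fun S hS => hS.elim (hp S) (hqs S)) d
        (hd.mono fun K hK => ih _ hK.2)

/-- The number of symbols of a term. -/
def Tm.size : {t : Ty} → Tm P Q t → ℕ
  | _, .prop _ | _, .top | _, .bot | _, .atom _ | _, .one | _, .zero => 1
  | _, .or A B | _, .and A B | _, .imp A B | _, .cap A B | _, .get A B | _, .fuse A B
  | _, .join A B | _, .meet A B => A.size + B.size + 1
  | _, .dia A | _, .poss A => A.size + 1

theorem ImmSub.size_lt {a b : AnyTm P Q} (h : ImmSub a b) : a.2.size < b.2.size := by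
  obtain ⟨t, b⟩ := b
  cases b <;> simp only [ImmSub, Tm.children, List.mem_cons, List.not_mem_nil, or_false] at h <;>
    first | exact h.elim | (rcases h with rfl | rfl <;> simp only [Tm.size] <;> omega)

theorem ProperSubterm.size_lt {a b : AnyTm P Q} (h : ProperSubterm a b) :
    a.2.size < b.2.size := by
  induction h with
  | single h => exact h.size_lt
  | tail _ h ih => exact ih.trans h.size_lt

/-- A proper subterm may be of the other type, so the induction on size runs over terms of both
types together. -/
theorem cutAdmissible (b : AnyTm P Q) : CutAdmissible b := by
  induction h : b.2.size using Nat.strong_induction_on generalizing b with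
  | _ n ih =>
    subst h
    exact prov_of_repl_suc fun c hc => ih _ hc.size_lt c rfl

theorem Derivation.allCuts_true {C : Calculus P Q} {H : Set (Sequent P Q)} {S : Sequent P Q}
    (d : Derivation C H S) : d.AllCuts fun _ => True := by
  induction d with
  | hyp _ => trivial
  | rule _ _ ds ih => exact ih
  | cut _ _ d e ihd ihe => exact ⟨trivial, ihd, ihe⟩

theorem Prov.of_derivable {S : Sequent P Q} (h : (calculus P Q).Derivable S) : Prov S := by
  obtain ⟨d⟩ := h
  exact prov_of_derivation (by simp) d (d.allCuts_true.mono fun K _ => cutAdmissible _)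

theorem cutElimination : (calculus P Q).CutElimination :=
  fun _ h => (Prov.of_derivable h).exists_cutFree

/-! ### The subformula property -/

theorem Derivation.AllSequents.mono {C : Calculus P Q} {H : Set (Sequent P Q)}
    {q q' : Sequent P Q → Prop} (h : ∀ S, q S → q' S) {S : Sequent P Q} {d : Derivation C H S}
    (hd : d.AllSequents q) : d.AllSequents q' := by
  induction d with
  | hyp _ => exact h _ hd
  | rule _ _ ds ih => exact ⟨h _ hd.1, fun i => ih i (hd.2 i)⟩
  | cut _ _ d e ihd ihe => exact ⟨h _ hd.1, ihd hd.2.1, ihe hd.2.2⟩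

theorem calculus_c1 : ∀ R ∈ (calculus P Q).rules, ∀ J ∈ R, ∀ S ∈ J.prems, ∀ a, S.HasTerm a →
    ∃ b, J.concl.HasTerm b ∧ Subterm a b := by
  intro R hR J hJ
  obtain ⟨s, σ, hs, rfl, -⟩ := goodRule hR J hJ
  exact hs.inst_c1

theorem analytic_of_cutFree {S : Sequent P Q} (d : Derivation (calculus P Q) ∅ S)
    (hd : d.CutFree) : d.Analytic := by
  induction d with
  | hyp h => exact h.elim
  | @rule R hR J hJ ds ih =>
    refine ⟨fun a ha => ⟨a, ha, .refl⟩, fun i => (ih i (hd i)).mono fun S' hS' a ha => ?_⟩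
    obtain ⟨b, hb, hab⟩ := hS' a ha
    obtain ⟨c, hc, hbc⟩ := calculus_c1 R hR J hJ _ (J.prems.get_mem i) b hb
    exact ⟨c, hc, hab.trans hbc⟩
  | cut _ _ d e ihd ihe => exact hd.1.elim

theorem subformulaProperty : (calculus P Q).SubformulaProperty := by
  refine ⟨fun S d hd => analytic_of_cutFree d hd, fun S hS => ?_⟩
  obtain ⟨d, hd⟩ := cutElimination S hS
  exact ⟨d, hd, analytic_of_cutFree d hd⟩

/-! ### Properness -/

theorem allRules_cases {R : Rule P Q} (h : R ∈ (calculus P Q).allRules) :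
    R ∈ (calculus P Q).rules ∨ R = Cut.toInference '' fmCut P Q ∨
      R = Cut.toInference '' resCut P Q := by
  rcases h with h | ⟨c, rfl | rfl, rfl⟩
  · exact .inl h
  · exact .inr (.inl rfl)
  · exact .inr (.inr rfl)

/-- An application of a rule is an instance of a well-formed schema or a cut. -/
theorem exists_of_mem_allRules {R : Rule P Q} (h : R ∈ (calculus P Q).allRules)
    {J : Inference P Q} (hJ : J ∈ R) : (∃ (s : Schema P Q) (σ : _), s.Good ∧ J = s.inst σ ∧
      ∀ σ', s.inst σ' ∈ R) ∨ ∃ K : Cut P Q, J = K.toInference ∧ ∀ K' : Cut P Q,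
        K'.ty = K.ty ∧ K'.left.lty = K.left.lty ∧ K'.left.rty = K.left.rty ∧ K'.pos = K.pos →
          K'.toInference ∈ R := by
  rcases allRules_cases h with h | rfl | rfl
  · exact .inl (goodRule h J hJ)
  · obtain ⟨K, ⟨h1, h2, h3⟩, rfl⟩ := hJ
    -- Membership in a cut rule depends only on types and on the address of the cut term.
    refine .inr ⟨K, rfl, fun K' ⟨e1, e2, e3, _⟩ => ⟨K', ⟨?_, ?_, ?_⟩, rfl⟩⟩
    · rw [e1, h1]
    · rw [e2, h2]
    · rw [e3, h3]
  · obtain ⟨K, ⟨h1, h2, h3, h4⟩, rfl⟩ := hJ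
    refine .inr ⟨K, rfl, fun K' ⟨e1, e2, e3, e4⟩ => ⟨K', ⟨?_, ?_, ?_, ?_⟩, rfl⟩⟩
    · rw [e1, h1]
    · rw [e2, h2]
    · rw [e3, h3]
    · rw [e4, h4]

theorem closedUnderSubst (ρ : Part) : (calculus P Q).ClosedUnderSubst ρ := by
  intro R hR J hJ l t a hl ha z
  rcases exists_of_mem_allRules hR hJ with ⟨s, σ, -, rfl, h⟩ | ⟨K, rfl, h⟩
  · obtain ⟨σ', h1, h2⟩ := Schema.inst_subst_parametric l hl z
    exact ⟨_, h σ', h1, h2⟩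
  · obtain ⟨K', h1, h2⟩ := K.subst_parametric l t a ρ hl ha z
    exact ⟨_, h K' h1, h2⟩

/-- The last rule suffices: the conclusion of a well-formed schema is type-uniform whatever its
premises are. -/
theorem typeUniform_of_prov {S : Sequent P Q} (h : Prov S) : S.TypeUniform := by
  obtain ⟨hR, hJ, -⟩ := h
  obtain ⟨s, σ, hs, rfl, -⟩ := goodRule hR _ hJ
  exact hs.uniform

/-- Only an identity axiom has its antecedent term recurring in the succedent. Hence surgical cuts
between axioms of the required form replace an atom by itself. -/
theorem cons_eq_of_isAxiom {t : Ty} {a : Tm P Q t} {z : Structure P Q t}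
    (h : (calculus P Q).IsAxiom ⟨(.tm a : Structure P Q t), z⟩)
    (hz : ∃ p, z.Occ suc p suc (.tm a : Structure P Q t)) : z = .tm a := by
  obtain ⟨p, hz⟩ := hz
  rcases isAxiom_cases h with ⟨p, h⟩ | ⟨p, h⟩ | h | h | h | h <;> cases h
  · rfl
  · rfl
  · cases hz
  · cases hz

theorem ante_eq_of_isAxiom {t : Ty} {a : Tm P Q t} {x : Structure P Q t}
    (h : (calculus P Q).IsAxiom ⟨x, (.tm a : Structure P Q t)⟩)
    (hx : ∃ p, x.Occ pre p pre (.tm a : Structure P Q t)) : x = .tm a := by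
  obtain ⟨p, hx⟩ := hx
  rcases isAxiom_cases h with ⟨p, h⟩ | ⟨p, h⟩ | h | h | h | h <;> cases h
  · rfl
  · rfl
  · cases hx
  · cases hx

theorem isProper : (calculus P Q).IsProper where
  c1 := calculus_c1
  c2 := by
    intro R hR J hJ
    rcases exists_of_mem_allRules hR hJ with ⟨s, σ, -, rfl, -⟩ | ⟨K, rfl, -⟩
    · exact Schema.inst_c2
    · exact K.c2
  c3 := by
    intro R hR J hJ
    rcases exists_of_mem_allRules hR hJ with ⟨s, σ, hs, rfl, -⟩ | ⟨K, rfl, -⟩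
    · exact hs.inst_c3
    · exact K.c3
  c4 := by
    intro R hR J hJ
    rcases exists_of_mem_allRules hR hJ with ⟨s, σ, hs, rfl, -⟩ | ⟨K, rfl, -⟩
    · exact hs.inst_c4
    · exact K.c4
  c5' := by
    intro R hR J hJ _ o ρ t a h
    rcases exists_of_mem_allRules hR hJ with ⟨s, σ, hs, rfl, -⟩ | ⟨K, rfl, -⟩
    · rw [hs.display (Schema.principal_iff.1 h)]
    · exact absurd h (K.not_principal o ρ a)
  c5'' := by
    intro R hR J hJ hp o ρ t a h
    -- No display step is needed: the principal terms of the axioms are already whole sides.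
    refine ⟨J.concl, .refl, ⟨R, hR, J, hJ, hp, rfl⟩, ?_⟩
    have h' := h.1
    obtain ⟨s, σ, hs, rfl, -⟩ := goodRule hR J hJ
    rwa [hs.display (Schema.principal_iff.1 h)] at h'
  c5''' := by
    intro t a S o o' v z hS ho ho' hz hz' hv hv'
    obtain rfl := cons_eq_of_isAxiom hz hz'
    obtain rfl := ante_eq_of_isAxiom hv hv'
    obtain ⟨π, p⟩ := o
    obtain ⟨π', p'⟩ := o'
    rw [Seq.replace_self (Seq.occ_iff.1 ho), Seq.replace_self (Seq.occ_iff.1 ho')]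
    exact ⟨hS, hS⟩
  c6' := closedUnderSubst suc
  c7' := closedUnderSubst pre
  c8' := fun _ _ _ _ _ hR₁ _ hJ₁ _ hR₂ _ hJ₂ h1 h1' h2 h2' =>
    derivableBy_of_principal hR₁ hJ₁ hR₂ hJ₂ h1 h1' h2 h2'
  c9 := fun _ h => typeUniform_of_prov (Prov.of_derivable h)
  -- Replacement preserves the type of each side, so type-uniformity of the conclusion is by
  -- definition that of the left premise.
  c10 := fun _ _ _ _ h _ => h

end

end DLRC

/-- D.LRC is a proper multi-type calculus, and it enjoys cut elimination and the subformula
property. -/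
theorem mainTheorem7 (AtProp AtRes : Type*) :
    (DLRC.calculus AtProp AtRes).IsProper ∧
      (DLRC.calculus AtProp AtRes).CutElimination ∧
      (DLRC.calculus AtProp AtRes).SubformulaProperty :=
  ⟨DLRC.isProper, DLRC.cutElimination, DLRC.subformulaProperty⟩
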